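/- **Setting.** Let $d\ge 0$ be an integer and, for integer $r\ge 1$, let $C^r$ mean $r$ times continuously differentiable jointly in $(\theta,\phi)\in\mathbb R\times\mathbb R^d$; "smooth" means $C^1$. A function of $(\theta,\phi)$ is called $2\pi$-periodic if it is $2\pi$-periodic in $\theta$ and in each $\phi_i$. A torus is given by an orbital tune $\omega\in\mathbb R^d$ and a smooth, $2\pi$-periodic field $\mathcal A(\theta,\phi)$ of real skew-symmetric $3\times3$ matrices. Let $\mathcal D=\partial_\theta+\omega\cdot\nabla_\phi$ and $\mathcal J=\begin{pmatrix}0&-1&0\\1&0&0\\0&0&0\end{pmatrix}$. *Precession frames.* For $\phi_0\in\mathbb R^d$, the principal solution matrix $\Phi(\cdot;\phi_0)$ solves $\partial_\theta\Phi=\mathcal A(\theta,\omega\theta+\phi_0)\Phi$, $\Phi(0;\phi_0)=I$. A function $U:\mathbb R\to SO(3)$ is a uniform precession frame (UPF) at $\phi_0$ with uniform precession rate (UPR) $\nu\in[0,1)$ if $\Phi(\theta;\phi_0)=U(\theta)\exp(\mathcal J\nu\theta)U(0)^T$ for all $\theta$. It is proper if each entry of $U$ has the form $\theta\mapsto F(\theta,\omega\theta)$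 with $F:\mathbb R^{d+1}\to\mathbb R$ continuous and $2\pi$-periodic in each variable. Call $\nu_1,\nu_2$ equivalent if $\nu_2=\varepsilon\nu_1+j_0+j\cdot\omega$ for some $\varepsilon\in\{1,-1\}$, $j_0\in\mathbb Z$, $j\in\mathbb Z^d$. The torus is well-tuned if a proper UPF exists at every $\phi_0$ and all UPRs of proper UPFs (at all $\phi_0$) are equivalent; these rates are then called spin tunes. *Frame fields.* An invariant frame field (IFF) is a smooth, $2\pi$-periodic $SO(3)$-valued field $\mathcal V(\theta,\phi)$ whose third column $\mathcal S$ satisfies $\mathcal D\mathcal S=\mathcal A\mathcal S$. Put $\mathcal C_{\mathcal V}=-\tfrac12\operatorname{Tr}[\mathcal J(\mathcal V^T\mathcal A\mathcal V-\mathcal V^T\mathcal D\mathcal V)]$; the IFF is uniform if $\mathcal C_{\mathcal V}$ is a constant in $[0,1)$. Put $c_{\mathcal V}(\theta;\phi_0)=\mathcal C_{\mathcal V}(\theta,\omega\theta+\phi_0)$, $\bar c_{\mathcal V}(\phi_0)=\lim_{T\to\infty}\frac1T\int_0^Tc_{\mathcal V}(\theta;\phi_0)\,d\theta$, $\tilde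 c_{\mathcal V}=c_{\mathcal V}-\bar c_{\mathcal V}$, and $\bar c_{\mathcal V}(\phi_0)=\nu_{\mathcal V}(\phi_0)+k_{\mathcal V}(\phi_0)$ with $\nu_{\mathcal V}(\phi_0)\in[0,1)$ and $k_{\mathcal V}(\phi_0)\in\mathbb Z$. The cohomological equation is $$\mathcal D\alpha(\theta,\phi)=\tilde c_{\mathcal V}(\theta;\phi-\omega\theta).\qquad(*)$$ Given a real-valued solution $\alpha$, put $$\mathcal U(\theta,\phi)=\mathcal V(\theta,\phi)\exp\bigl(\mathcal J(\alpha(\theta,\phi)+k_{\mathcal V}(\phi-\omega\theta)\theta)\bigr),\qquad U(\theta;\phi_0)=\mathcal U(\theta,\omega\theta+\phi_0).$$ *Arithmetic.* The torus is off orbital resonance if $m\cdot(1,\omega)\ne0$ for all nonzero $m\in\mathbb Z^{d+1}$. For $\tau>0$, $\Omega(\tau)$ is the set of $\omega\in\mathbb R^d$ for which there is $\gamma\in(0,1]$ with $|m\cdot(1,\omega)|\ge\gamma\|m\|^{-\tau}$ for all nonzero $m\in\mathbb Z^{d+1}$, where $\|\cdot\|$ is the max norm. **Theorem.** (a) If $\mathcal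 V$ is an IFF and $(*)$ has a smooth $2\pi$-periodic solution $\alpha$, then for every $\phi_0\in\mathbb R^d$ the mean $\bar c_{\mathcal V}(\phi_0)$ exists as a limit and $U(\cdot;\phi_0)$ is a proper UPF at $\phi_0$ with UPR $\nu_{\mathcal V}(\phi_0)$. (b) If moreover the torus is off orbital resonance, then $\mathcal U$ is a uniform IFF, $\nu_{\mathcal V}$ is constant and $\mathcal C_{\mathcal U}=\nu_{\mathcal V}$, the torus is well-tuned, and for every $\phi_0$ the function $U(\cdot;\phi_0)$ is a proper UPF at $\phi_0$ whose UPR equals $\mathcal C_{\mathcal U}=\nu_{\mathcal V}$ and is a spin tune. (c) Let $r\in\mathbb N$ and $0<\tau<r-d-3$. If $\mathcal A$ is $C^r$, a $C^r$ IFF exists, and $\omega\in\Omega(\tau)$, then a uniform IFF exists, and the torus is well-tuned. (d) Let $r\in\mathbb N$, $r>2d+4$, let $R\subset\mathbb R^d$ be a Borel set, and for each $\omega\in R$ let $\mathcal A_\omega$ be a $C^r$ field as above (for instance the same field for all $\omega$) such that the torus given by $\omega$ and $\mathcal A_\omega$ has a $C^r$ IFF. Then for Lebesgue-almost every $\omega\in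 R$ the torus given by $\omega$ and $\mathcal A_\omega$ has a uniform IFF and is well-tuned. -/

import Mathlib

open Filter Topology MeasureTheory
open scoped Matrix

noncomputable section

namespace SpinTorus

/-- Real `3 × 3` matrices. -/
abbrev M3 : Type := Matrix (Fin 3) (Fin 3) ℝ

/-- A matrix valued field `(θ, φ) ↦ 𝒱(θ, φ)` on `ℝ × ℝᵈ`. -/
abbrev MatField (d : ℕ) : Type := ℝ → (Fin d → ℝ) → M3

/-! ### Smoothness, periodicity and the derivation along the orbital flow -/

/-- A real function of `(θ, φ)` is `2π`-periodic in each of `φ₁, …, φ_d`. -/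
def PeriodicPhi {d : ℕ} {X : Type} (f : ℝ → (Fin d → ℝ) → X) : Prop :=
  ∀ (θ : ℝ) (φ : Fin d → ℝ) (i : Fin d), f θ (φ + Pi.single i (2 * Real.pi)) = f θ φ

/-- A function of `(θ, φ)` is `2π`-periodic in `θ`. -/
def PeriodicTheta {d : ℕ} {X : Type} (f : ℝ → (Fin d → ℝ) → X) : Prop :=
  ∀ (θ : ℝ) (φ : Fin d → ℝ), f (θ + 2 * Real.pi) φ = f θ φ

/-- A real function of `(θ, φ)` is of class `C^r`, jointly in `(θ, φ)`. -/
def IsCr {d : ℕ} (r : ℕ) (f : ℝ → (Fin d → ℝ) → ℝ) : Prop :=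
  ContDiff ℝ (r : WithTop ℕ∞) (fun p : ℝ × (Fin d → ℝ) => f p.1 p.2)

/-- A matrix field is of class `C^r` if its entries are. -/
def MatField.IsCr {d : ℕ} (r : ℕ) (V : MatField d) : Prop :=
  ∀ i j, SpinTorus.IsCr r (fun θ φ => V θ φ i j)

/-- The derivation `𝒟 f = ∂_θ f + ω · ∇_φ f`, written as the derivative of `f`
in the direction `(1, ω)`. It is only applied to `C¹` functions. -/
def DD {d : ℕ} (ω : Fin d → ℝ) (f : ℝ → (Fin d → ℝ) → ℝ) (θ : ℝ) (φ : Fin d → ℝ) : ℝ :=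
  fderiv ℝ (fun p : ℝ × (Fin d → ℝ) => f p.1 p.2) (θ, φ) (1, ω)

/-- The derivation `𝒟` acting entrywise on a matrix field. -/
def DDMat {d : ℕ} (ω : Fin d → ℝ) (V : MatField d) : MatField d :=
  fun θ φ => Matrix.of fun i j => DD ω (fun t x => V t x i j) θ φ

/-- For a differentiable function, `𝒟 f` is the sum of partial derivatives
`∂_θ f + ∑ i, ω i * ∂_{φ_i} f`. -/
theorem DD_eq_partials {d : ℕ} (ω : Fin d → ℝ) (f : ℝ → (Fin d → ℝ) → ℝ) (θ : ℝ)
    (φ : Fin d → ℝ)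
    (hf : DifferentiableAt ℝ (fun p : ℝ × (Fin d → ℝ) => f p.1 p.2) (θ, φ)) :
    DD ω f θ φ = deriv (fun t => f t φ) θ
      + ∑ i, ω i * deriv (fun s => f θ (Function.update φ i s)) (φ i) := by
  have h1 : HasDerivAt (fun t => f t φ)
      (fderiv ℝ (fun p : ℝ × (Fin d → ℝ) => f p.1 p.2) (θ, φ) (1, 0)) θ := by
    have := hf.hasFDerivAt.comp_hasDerivAt θ
      ((hasDerivAt_id θ).prodMk (hasDerivAt_const θ φ))
    exact this
  have h2 : ∀ i, HasDerivAt (fun s => f θ (Function.update φ i s))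
      (fderiv ℝ (fun p : ℝ × (Fin d → ℝ) => f p.1 p.2) (θ, φ) (0, Pi.single i 1)) (φ i) := by
    intro i
    have hf' : DifferentiableAt ℝ (fun p : ℝ × (Fin d → ℝ) => f p.1 p.2)
        (θ, Function.update φ i (φ i)) := by simpa using hf
    have := hf'.hasFDerivAt.comp_hasDerivAt (φ i)
      ((hasDerivAt_const (φ i) θ).prodMk (hasDerivAt_update φ i (φ i)))
    rw [Function.update_eq_self] at this
    exact this
  have h3 : ((1 : ℝ), ω) = (1, 0) + ∑ i, ω i • ((0 : ℝ), (Pi.single i 1 : Fin d → ℝ)) := by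
    refine Prod.ext ?_ ?_
    · simp [Prod.fst_sum]
    · ext j
      simp [Prod.snd_sum, Finset.sum_apply, Pi.single_apply]
  unfold DD
  rw [h1.deriv, h3, map_add, map_sum]
  congr 1
  refine Finset.sum_congr rfl fun i _ => ?_
  rw [(h2 i).deriv, map_smul, smul_eq_mul]

/-! ### Quasiperiodic functions, resonance, Diophantine sets -/

/-- `f : ℝ → ℝ` is quasiperiodic with tune vector `ν ∈ ℝᵏ`: `f(θ) = F(νθ)` with `F`
continuous and `2π`-periodic on `ℝᵏ`. -/
def Quasiperiodic {k : ℕ} (ν : Fin k → ℝ) (f : ℝ → ℝ) : Prop :=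
  ∃ F : (Fin k → ℝ) → ℝ, Continuous F ∧
    (∀ z i, F (z + Pi.single i (2 * Real.pi)) = F z) ∧ ∀ θ, f θ = F (θ • ν)

/-- A matrix valued function is quasiperiodic if its entries are. -/
def QuasiperiodicMat {k : ℕ} (ν : Fin k → ℝ) (U : ℝ → M3) : Prop :=
  ∀ i j, Quasiperiodic ν (fun θ => U θ i j)

/-- The mean `lim_{T → ∞} (1/T) ∫₀ᵀ f(θ) dθ` of `f` exists and equals `m`. -/
def HasMean (f : ℝ → ℝ) (m : ℝ) : Prop :=
  Tendsto (fun T : ℝ => T⁻¹ * ∫ θ in (0 : ℝ)..T, f θ) atTop (𝓝 m)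

/-- The mean `lim_{T → ∞} (1/T) ∫₀ᵀ f(θ) dθ` of `f`. -/
def mean (f : ℝ → ℝ) : ℝ :=
  limUnder atTop (fun T : ℝ => T⁻¹ * ∫ θ in (0 : ℝ)..T, f θ)

/-- The tune vector `(1, ω) ∈ ℝ^{d+1}`. -/
def tuneVec {d : ℕ} (ω : Fin d → ℝ) : Fin (d + 1) → ℝ := Fin.cons 1 ω

/-- `m · ν` for `m ∈ ℤᵏ` and `ν ∈ ℝᵏ`. -/
def intDot {k : ℕ} (m : Fin k → ℤ) (ν : Fin k → ℝ) : ℝ := ∑ i, (m i : ℝ) * ν i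

/-- `ν ∈ ℝᵏ` is nonresonant: `m · ν = 0` with `m ∈ ℤᵏ` only for `m = 0`. -/
def Nonresonant {k : ℕ} (ν : Fin k → ℝ) : Prop :=
  ∀ m : Fin k → ℤ, intDot m ν = 0 → m = 0

/-- The torus with orbital tune `ω` is off orbital resonance. -/
def OffOrbitalResonance {d : ℕ} (ω : Fin d → ℝ) : Prop := Nonresonant (tuneVec ω)

/-- The Diophantine set `Ω(τ)`: those `ω` for which some `γ ∈ (0, 1]` satisfies
`|m · (1, ω)| ≥ γ ‖m‖^{-τ}` for all nonzero `m ∈ ℤ^{d+1}`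
(`‖m‖` is the max norm, which is the norm of Mathlib's `Fin (d + 1) → ℤ`). -/
def DiophantineSet (d : ℕ) (τ : ℝ) : Set (Fin d → ℝ) :=
  {ω | ∃ γ : ℝ, 0 < γ ∧ γ ≤ 1 ∧
    ∀ m : Fin (d + 1) → ℤ, m ≠ 0 → γ * ‖m‖ ^ (-τ) ≤ |intDot m (tuneVec ω)|}

/-! ### The spin equation of motion on a fixed torus -/

/-- Standing assumptions on the field `𝒜` of the spin equation
`dS/dθ = 𝒜(θ, ωθ + φ₀) S`: skew-symmetric, `C¹` and `2π`-periodic in `θ` and `φ`. -/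
structure IsSpinSystem {d : ℕ} (A : MatField d) : Prop where
  skew : ∀ θ φ, (A θ φ)ᵀ = -A θ φ
  smooth : A.IsCr 1
  periodicTheta : PeriodicTheta A
  periodicPhi : PeriodicPhi A

/-- The generator `𝒥` of rotations about the third axis. -/
def JJ : M3 := !![0, -1, 0; 1, 0, 0; 0, 0, 0]

/-- `exp(𝒥 t)`, the rotation by the angle `t` about the third axis. -/
def expJ (t : ℝ) : M3 := NormedSpace.exp (t • JJ)

/-- `R ∈ SO(3)`. -/
def IsSO3 (R : M3) : Prop := R ∈ Matrix.specialOrthogonalGroup (Fin 3) ℝ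

/-- `Φ` is the principal solution matrix at `φ₀`: `∂_θ Φ = 𝒜(θ, ωθ + φ₀) Φ`, `Φ(0) = I`.
It is unique, this being a linear initial value problem. -/
def IsPrincipalSolution {d : ℕ} (A : MatField d) (ω φ₀ : Fin d → ℝ) (Φ : ℝ → M3) : Prop :=
  (∀ θ i j, HasDerivAt (fun t => Φ t i j) ((A θ (θ • ω + φ₀) * Φ θ) i j) θ) ∧ Φ 0 = 1

/-- `U` is a uniform precession frame (UPF) at `φ₀` with uniform precession rate (UPR) `ν`:
`U(θ) ∈ SO(3)`, `ν ∈ [0, 1)`, and the principal solution matrix at `φ₀` is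
`U(θ) exp(𝒥νθ) U(0)ᵀ`. -/
def IsUPF {d : ℕ} (A : MatField d) (ω φ₀ : Fin d → ℝ) (U : ℝ → M3) (ν : ℝ) : Prop :=
  (∀ θ, IsSO3 (U θ)) ∧ ν ∈ Set.Ico (0 : ℝ) 1 ∧
    IsPrincipalSolution A ω φ₀ (fun θ => U θ * expJ (ν * θ) * (U 0)ᵀ)

/-- A UPF is proper if it is quasiperiodic with tune vector `(1, ω)`. -/
def IsProperUPF {d : ℕ} (A : MatField d) (ω φ₀ : Fin d → ℝ) (U : ℝ → M3) (ν : ℝ) : Prop :=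
  IsUPF A ω φ₀ U ν ∧ QuasiperiodicMat (tuneVec ω) U

/-- The equivalence `ν₁ ∼ ν₂`: `ν₂ = ε ν₁ + j₀ + j · ω` with `ε = ±1` and integers `j₀, j`. -/
def TuneEquiv {d : ℕ} (ω : Fin d → ℝ) (ν₁ ν₂ : ℝ) : Prop :=
  ∃ (ε : ℝ) (j₀ : ℤ) (j : Fin d → ℤ), (ε = 1 ∨ ε = -1) ∧ ν₂ = ε * ν₁ + j₀ + intDot j ω

/-- The torus is well-tuned: a proper UPF exists at every `φ₀`, and all proper UPRs on the
torus are equivalent. -/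
def WellTuned {d : ℕ} (A : MatField d) (ω : Fin d → ℝ) : Prop :=
  (∀ φ₀, ∃ U ν, IsProperUPF A ω φ₀ U ν) ∧
    ∀ φ₁ φ₂ U₁ U₂ ν₁ ν₂, IsProperUPF A ω φ₁ U₁ ν₁ → IsProperUPF A ω φ₂ U₂ ν₂ →
      TuneEquiv ω ν₁ ν₂

/-- `ν` is a spin tune: the torus is well-tuned and `ν` is a proper UPR at some `φ₀`. -/
def IsSpinTune {d : ℕ} (A : MatField d) (ω : Fin d → ℝ) (ν : ℝ) : Prop :=
  WellTuned A ω ∧ ∃ φ₀ U, IsProperUPF A ω φ₀ U ν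

/-! ### Spin fields and invariant frame fields -/

/-- `𝒮` is a spin field: `C¹`, `2π`-periodic in `φ`, and `𝒟𝒮 = 𝒜𝒮`. -/
def IsSpinField {d : ℕ} (A : MatField d) (ω : Fin d → ℝ)
    (S : ℝ → (Fin d → ℝ) → Fin 3 → ℝ) : Prop :=
  (∀ i, IsCr 1 (fun θ φ => S θ φ i)) ∧ PeriodicPhi S ∧
    ∀ θ φ i, DD ω (fun t x => S t x i) θ φ = (A θ φ *ᵥ S θ φ) i

/-- `𝒱` is a frame field: `SO(3)` valued, `C¹`, `2π`-periodic in `φ`, and its third column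
is a spin field. -/
def IsFrameField {d : ℕ} (A : MatField d) (ω : Fin d → ℝ) (V : MatField d) : Prop :=
  (∀ θ φ, IsSO3 (V θ φ)) ∧ V.IsCr 1 ∧ PeriodicPhi V ∧
    IsSpinField A ω (fun θ φ i => V θ φ i 2)

/-- An invariant frame field (IFF) is a frame field that is also `2π`-periodic in `θ`. -/
def IsIFF {d : ℕ} (A : MatField d) (ω : Fin d → ℝ) (V : MatField d) : Prop :=
  IsFrameField A ω V ∧ PeriodicTheta V

/-- The function `𝒞_𝒱 = -(1/2) Tr[𝒥 (𝒱ᵀ𝒜𝒱 - 𝒱ᵀ 𝒟𝒱)]`. -/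
def CC {d : ℕ} (A : MatField d) (ω : Fin d → ℝ) (V : MatField d) (θ : ℝ) (φ : Fin d → ℝ) : ℝ :=
  -(1 / 2) * (JJ * ((V θ φ)ᵀ * A θ φ * V θ φ - (V θ φ)ᵀ * DDMat ω V θ φ)).trace

/-- An IFF is uniform if `𝒞_𝒱` is a constant in `[0, 1)`. -/
def IsUniformIFF {d : ℕ} (A : MatField d) (ω : Fin d → ℝ) (V : MatField d) : Prop :=
  IsIFF A ω V ∧ ∃ ν ∈ Set.Ico (0 : ℝ) 1, ∀ θ φ, CC A ω V θ φ = ν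

/-! ### Straightening an invariant frame field -/

/-- `c_𝒱(θ; φ₀) = 𝒞_𝒱(θ, ωθ + φ₀)`. -/
def cV {d : ℕ} (A : MatField d) (ω : Fin d → ℝ) (V : MatField d) (φ₀ : Fin d → ℝ) (θ : ℝ) : ℝ :=
  CC A ω V θ (θ • ω + φ₀)

/-- The mean `c̄_𝒱(φ₀)` of `c_𝒱(·; φ₀)`. -/
def cBar {d : ℕ} (A : MatField d) (ω : Fin d → ℝ) (V : MatField d) (φ₀ : Fin d → ℝ) : ℝ :=
  mean (cV A ω V φ₀)

/-- The zero-mean part `c̃_𝒱(θ; φ₀) = c_𝒱(θ; φ₀) - c̄_𝒱(φ₀)`. -/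
def cTilde {d : ℕ} (A : MatField d) (ω : Fin d → ℝ) (V : MatField d) (φ₀ : Fin d → ℝ)
    (θ : ℝ) : ℝ :=
  cV A ω V φ₀ θ - cBar A ω V φ₀

/-- The integer `k_𝒱(φ₀)` with `c̄_𝒱(φ₀) = ν_𝒱(φ₀) + k_𝒱(φ₀)`, `ν_𝒱(φ₀) ∈ [0, 1)`. -/
def kV {d : ℕ} (A : MatField d) (ω : Fin d → ℝ) (V : MatField d) (φ₀ : Fin d → ℝ) : ℤ :=
  ⌊cBar A ω V φ₀⌋

/-- `ν_𝒱(φ₀) ∈ [0, 1)`, the fractional part of `c̄_𝒱(φ₀)`. -/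
def nuV {d : ℕ} (A : MatField d) (ω : Fin d → ℝ) (V : MatField d) (φ₀ : Fin d → ℝ) : ℝ :=
  Int.fract (cBar A ω V φ₀)

/-- `α` is a `C¹` and `2π`-periodic solution of the cohomological equation
`𝒟α(θ, φ) = c̃_𝒱(θ; φ - ωθ)`. -/
def SolvesCohomological {d : ℕ} (A : MatField d) (ω : Fin d → ℝ) (V : MatField d)
    (α : ℝ → (Fin d → ℝ) → ℝ) : Prop :=
  IsCr 1 α ∧ PeriodicTheta α ∧ PeriodicPhi α ∧
    ∀ θ φ, DD ω α θ φ = cTilde A ω V (φ - θ • ω) θ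

/-- `𝒰(θ, φ) = 𝒱(θ, φ) exp(𝒥 (α(θ, φ) + k_𝒱(φ - ωθ) θ))`. -/
def UU {d : ℕ} (A : MatField d) (ω : Fin d → ℝ) (V : MatField d)
    (α : ℝ → (Fin d → ℝ) → ℝ) : MatField d :=
  fun θ φ => V θ φ * expJ (α θ φ + (kV A ω V (φ - θ • ω) : ℝ) * θ)

/-- `U(θ; φ₀) = 𝒰(θ, ωθ + φ₀) = 𝒱(θ, ωθ + φ₀) exp(𝒥 (α(θ, ωθ + φ₀) + k_𝒱(φ₀) θ))`. -/
def UFrame {d : ℕ} (A : MatField d) (ω : Fin d → ℝ) (V : MatField d)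
    (α : ℝ → (Fin d → ℝ) → ℝ) (φ₀ : Fin d → ℝ) (θ : ℝ) : M3 :=
  UU A ω V α θ (θ • ω + φ₀)

end SpinTorus

end

open SpinTorus

/-!
The spin equation in an invariant frame `𝒱` is `𝒟𝒱 = 𝒜𝒱 - 𝒞_𝒱 𝒱𝒥` (`DDMat_frame`): relative to the
frame, spins rotate about the third axis at the rate `𝒞_𝒱`. Rotating the frame by an angle `β` whose
rate along an orbit is `c_𝒱 - ν` therefore produces a frame rotating at the constant rate `ν`, that
is, a uniform precession frame (`isUPF_rotated_frame`). A solution `α` of the cohomological equation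
supplies the angle `β = α + k_𝒱 θ`. As `α` is bounded, the mean of `c_𝒱` exists (`hasMean_cV`),
and since `k_𝒱` is an integer the frame is quasiperiodic (`isProperUPF_UFrame`).

Off orbital resonance, Weyl's equidistribution theorem (`HasComplexMean.eq_of_nonresonant`) makes
the mean independent of the orbit, so that the straightened frame is a smooth field
(`isIFF_UU`). For the equivalence of the rates of two proper frames `U₁`, `U₂` at the same `φ₀`, the
matrix `U₁ᵀU₂` is quasiperiodic, and it equals `exp(𝒥ν₁θ) M exp(-𝒥ν₂θ)` with a constant rotation
`M`. Its upper left block contains a nonzero multiple of `exp(i(ν₁ - ν₂)θ)` or of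
`exp(i(ν₁ + ν₂)θ)` (`IsSO3.rotPart_ne_zero_or`), and such an exponential is quasiperiodic only if its
frequency is an integer combination of `1` and `ω` (`exists_intDot_eq_of_quasiperiodic`).

For Diophantine `ω` the cohomological equation is solved by Fourier series
(`exists_solution_cohomological`). As `𝒞_𝒱` is of class `C^{r-1}`, its coefficients are
`O(‖m‖^{-(r-1)})` (`exists_bound_mFourierCoeff`); the small denominators cost `‖m‖^τ` and one
derivative of `α` costs `‖m‖`, so that the differentiated series converges if
`r - 2 - τ > d + 1`. Finally almost every `ω` lies in `Ω(τ)` for `τ > d + 1`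
(`ae_mem_diophantineSet`), and such a `τ` below `r - d - 3` exists if `r > 2d + 4`.
-/

namespace SpinTorus

/-! ### Rotations about the third axis -/

/-- The rotation by the angle `t` about the third axis, in coordinates. -/
theorem expJ_eq (t : ℝ) :
    expJ t = !![Real.cos t, -Real.sin t, 0; Real.sin t, Real.cos t, 0; 0, 0, 1] := by
  let : NormedRing M3 := Matrix.linftyOpNormedRing
  let : NormedAlgebra ℝ M3 := Matrix.linftyOpNormedAlgebra
  -- `R` is the inverse rotation; `exp(s𝒥) R(s)` has zero derivative, hence equals `1`.
  let R : ℝ → M3 := fun s => !![Real.cos s, Real.sin s, 0; -Real.sin s, Real.cos s, 0; 0, 0, 1]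
  let R' : ℝ → M3 := fun s => !![-Real.sin s, Real.cos s, 0; -Real.cos s, -Real.sin s, 0; 0, 0, 0]
  have hR : ∀ s, HasDerivAt R (R' s) s := by
    intro s
    have hc := Real.hasDerivAt_cos s
    have hs := Real.hasDerivAt_sin s
    refine hasDerivAt_pi.2 fun i => hasDerivAt_pi.2 fun j => ?_
    fin_cases i <;> fin_cases j <;> simp [R, R'] <;>
      first
        | exact hc | exact hs | exact hs.neg | exact hasDerivAt_const _ _
  have hE : ∀ s : ℝ, HasDerivAt (fun u : ℝ => NormedSpace.exp (u • JJ))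
      (NormedSpace.exp (s • JJ) * JJ) s := fun s => hasDerivAt_exp_smul_const JJ s
  have hJ : ∀ s, JJ * R s + R' s = 0 := by
    intro s
    ext i j
    fin_cases i <;> fin_cases j <;> simp [JJ, R, R']
  have hprod : ∀ s, HasDerivAt (fun u : ℝ => NormedSpace.exp (u • JJ) * R u) 0 s := by
    intro s
    have h := (hE s).mul (hR s)
    rwa [mul_assoc, ← mul_add, hJ, mul_zero] at h
  have hconst : NormedSpace.exp (t • JJ) * R t = NormedSpace.exp ((0 : ℝ) • JJ) * R 0 :=
    is_const_of_deriv_eq_zero (fun s => (hprod s).differentiableAt)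
      (fun s => (hprod s).deriv) t 0
  have hR0 : R 0 = 1 := by
    ext i j
    fin_cases i <;> fin_cases j <;> simp [R]
  have hRR : R t * !![Real.cos t, -Real.sin t, 0; Real.sin t, Real.cos t, 0; 0, 0, 1] = 1 := by
    have h := Real.cos_sq_add_sin_sq t
    ext i j
    fin_cases i <;> fin_cases j <;>
      simp [R, Matrix.mul_apply, Fin.sum_univ_three] <;> nlinarith
  rw [hR0, zero_smul, NormedSpace.exp_zero, one_mul] at hconst
  unfold expJ
  calc _ = NormedSpace.exp (t • JJ) * (R t *
        !![Real.cos t, -Real.sin t, 0; Real.sin t, Real.cos t, 0; 0, 0, 1]) := by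
        rw [hRR, mul_one]
    _ = _ := by rw [← mul_assoc, hconst, one_mul]

theorem expJ_zero : expJ 0 = 1 := by
  rw [expJ_eq]
  ext i j
  fin_cases i <;> fin_cases j <;> simp

theorem expJ_add (s t : ℝ) : expJ (s + t) = expJ s * expJ t := by
  simp only [expJ_eq, Real.cos_add, Real.sin_add]
  ext i j
  fin_cases i <;> fin_cases j <;> simp [Matrix.mul_apply, Fin.sum_univ_three] <;> ring

theorem transpose_expJ (t : ℝ) : (expJ t)ᵀ = expJ (-t) := by
  simp only [expJ_eq, Real.cos_neg, Real.sin_neg]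
  ext i j
  fin_cases i <;> fin_cases j <;> simp

theorem transpose_expJ_mul (t : ℝ) : (expJ t)ᵀ * expJ t = 1 := by
  rw [transpose_expJ, ← expJ_add, neg_add_cancel, expJ_zero]

theorem JJ_mul_expJ (t : ℝ) : JJ * expJ t = expJ t * JJ := by
  rw [expJ_eq]
  ext i j
  fin_cases i <;> fin_cases j <;> simp [JJ, Matrix.mul_apply, Fin.sum_univ_three]

theorem isSO3_expJ (t : ℝ) : IsSO3 (expJ t) := by
  rw [IsSO3, Matrix.mem_specialOrthogonalGroup_iff, Matrix.mem_orthogonalGroup_iff']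
  refine ⟨transpose_expJ_mul t, ?_⟩
  rw [expJ_eq, Matrix.det_fin_three]
  simp
  nlinarith [Real.cos_sq_add_sin_sq t]

theorem IsSO3.mul {P Q : M3} (hP : IsSO3 P) (hQ : IsSO3 Q) : IsSO3 (P * Q) :=
  mul_mem hP hQ

theorem IsSO3.transpose_mul {P : M3} (hP : IsSO3 P) : Pᵀ * P = 1 := by
  rw [IsSO3, Matrix.mem_specialOrthogonalGroup_iff, Matrix.mem_orthogonalGroup_iff'] at hP
  simpa [Matrix.star_eq_conjTranspose, Matrix.conjTranspose_eq_transpose_of_trivial] using hP.1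

theorem IsSO3.mul_transpose {P : M3} (hP : IsSO3 P) : P * Pᵀ = 1 :=
  mul_eq_one_comm.1 hP.transpose_mul

theorem expJ_add_int (t : ℝ) (n : ℤ) : expJ (t + n * (2 * Real.pi)) = expJ t := by
  simp only [expJ_eq, Real.cos_add_int_mul_two_pi, Real.sin_add_int_mul_two_pi]

theorem contDiff_expJ_apply (i j : Fin 3) {n : WithTop ℕ∞} :
    ContDiff ℝ n fun t => expJ t i j := by
  simp only [expJ_eq]
  fin_cases i <;> fin_cases j <;> simp <;> fun_prop

theorem hasDerivAt_expJ_apply (t : ℝ) (i j : Fin 3) :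
    HasDerivAt (fun s => expJ s i j) ((JJ * expJ t) i j) t := by
  have hc := Real.hasDerivAt_cos t
  have hs := Real.hasDerivAt_sin t
  simp only [expJ_eq]
  fin_cases i <;> fin_cases j <;> simp [JJ, Matrix.mul_apply, Fin.sum_univ_three] <;>
    first
      | exact hc | exact hs | exact hs.neg | exact hasDerivAt_const _ _

/-- Product rule for matrix valued functions with entrywise derivatives. -/
theorem hasDerivAt_matrix_mul {P Q : ℝ → M3} {P' Q' : M3} {t : ℝ}
    (hP : ∀ i j, HasDerivAt (fun s => P s i j) (P' i j) t)
    (hQ : ∀ i j, HasDerivAt (fun s => Q s i j) (Q' i j) t) (i j : Fin 3) :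
    HasDerivAt (fun s => (P s * Q s) i j) ((P' * Q t + P t * Q') i j) t := by
  simp only [Matrix.mul_apply, Matrix.add_apply, ← Finset.sum_add_distrib]
  exact HasDerivAt.fun_sum fun k _ => (hP i k).mul (hQ k j)

/-! ### Periodic functions on `ℝᵏ` and trigonometric polynomials -/

/-- `F` is `2π`-periodic in each of its `k` variables. -/
def PeriodicVec {k : ℕ} {X : Type} (F : (Fin k → ℝ) → X) : Prop :=
  ∀ z i, F (z + Pi.single i (2 * Real.pi)) = F z

theorem PeriodicVec.add_single_int {k : ℕ} {X : Type} {F : (Fin k → ℝ) → X}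
    (hF : PeriodicVec F) (z : Fin k → ℝ) (i : Fin k) (n : ℤ) :
    F (z + Pi.single i (n * (2 * Real.pi))) = F z := by
  have h : Function.Periodic (fun t : ℝ => F (z + Pi.single i t)) (2 * Real.pi) := by
    intro t
    have := hF (z + Pi.single i t) i
    rwa [add_assoc, ← Pi.single_add] at this
  simpa using h.int_mul n 0

theorem PeriodicVec.add_sum_single {k : ℕ} {X : Type} {F : (Fin k → ℝ) → X}
    (hF : PeriodicVec F) (z : Fin k → ℝ) (n : Fin k → ℤ) (s : Finset (Fin k)) :
    F (z + ∑ i ∈ s, Pi.single i (n i * (2 * Real.pi))) = F z := by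
  classical
  induction s using Finset.induction_on with
  | empty => simp
  | insert i s hi ih =>
    rw [Finset.sum_insert hi, add_comm (Pi.single i _), ← add_assoc, hF.add_single_int, ih]

/-- A function periodic in each variable is invariant under the lattice `2πℤᵏ`. -/
theorem PeriodicVec.add_int {k : ℕ} {X : Type} {F : (Fin k → ℝ) → X}
    (hF : PeriodicVec F) (z : Fin k → ℝ) (n : Fin k → ℤ) :
    F (z + fun i => n i * (2 * Real.pi)) = F z := by
  rw [← hF.add_sum_single z n Finset.univ, Finset.univ_sum_single]

/-- The projection `ℝᵏ → (ℝ/ℤ)ᵏ`, rescaled so that `2π` is mapped to `0`. -/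
noncomputable def toTorus {k : ℕ} (z : Fin k → ℝ) : UnitAddTorus (Fin k) :=
  fun i => ((z i / (2 * Real.pi) : ℝ) : UnitAddCircle)

theorem isOpenQuotientMap_toTorus (k : ℕ) :
    IsOpenQuotientMap (toTorus : (Fin k → ℝ) → UnitAddTorus (Fin k)) := by
  have h1 : IsOpenQuotientMap (fun x : ℝ => (x : UnitAddCircle)) :=
    QuotientAddGroup.isOpenQuotientMap_mk
  have h2 : IsOpenQuotientMap (fun x : ℝ => x / (2 * Real.pi)) :=
    (Homeomorph.mulRight₀ (2 * Real.pi)⁻¹ (by positivity)).isOpenQuotientMap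
  exact IsOpenQuotientMap.piMap (fun _ : Fin k => h1.comp h2)

/-- A continuous `2π`-periodic function on `ℝᵏ` descends to the torus. -/
theorem exists_torus_lift {k : ℕ} {F : (Fin k → ℝ) → ℂ} (hc : Continuous F)
    (hF : PeriodicVec F) :
    ∃ g : C(UnitAddTorus (Fin k), ℂ), ∀ z, g (toTorus z) = F z := by
  have hq := (isOpenQuotientMap_toTorus k).isQuotientMap
  have hfib : ∀ z w : Fin k → ℝ, toTorus z = toTorus w → F z = F w := by
    intro z w h
    have h' : ∀ i, ∃ n : ℤ, z i = w i + n * (2 * Real.pi) := by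
      intro i
      have hi : ((z i / (2 * Real.pi) : ℝ) : UnitAddCircle) = ((w i / (2 * Real.pi) : ℝ)) :=
        congrFun h i
      rw [← sub_eq_zero, ← AddCircle.coe_sub, AddCircle.coe_eq_zero_iff] at hi
      obtain ⟨n, hn⟩ := hi
      refine ⟨n, ?_⟩
      have : (2 * Real.pi) ≠ 0 := by positivity
      rw [zsmul_eq_mul, mul_one] at hn
      field_simp at hn
      linarith
    choose n hn using h'
    rw [show z = w + fun i => n i * (2 * Real.pi) from funext hn, hF.add_int]
  let p : C(Fin k → ℝ, UnitAddTorus (Fin k)) := ⟨toTorus, hq.continuous⟩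
  have hp : IsQuotientMap p := hq
  have hfac : Function.FactorsThrough (⟨F, hc⟩ : C(Fin k → ℝ, ℂ)) p := hfib
  exact ⟨hp.lift ⟨F, hc⟩ hfac, fun z => congrArg (fun f => f z) (hp.lift_comp ⟨F, hc⟩ hfac)⟩

theorem PeriodicVec.exists_bound {k : ℕ} {F : (Fin k → ℝ) → ℂ} (hc : Continuous F)
    (hF : PeriodicVec F) : ∃ C, ∀ z, ‖F z‖ ≤ C := by
  obtain ⟨g, hg⟩ := exists_torus_lift hc hF
  exact ⟨‖g‖, fun z => by rw [← hg]; exact g.norm_coe_le_norm _⟩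

/-- The character `z ↦ exp(i m·z)` of `ℝᵏ`. -/
noncomputable def character {k : ℕ} (m : Fin k → ℤ) (z : Fin k → ℝ) : ℂ :=
  Complex.exp (intDot m z * Complex.I)

theorem norm_character {k : ℕ} (m : Fin k → ℤ) (z : Fin k → ℝ) : ‖character m z‖ = 1 :=
  Complex.norm_exp_ofReal_mul_I _

theorem intDot_add {k : ℕ} (m : Fin k → ℤ) (z w : Fin k → ℝ) :
    intDot m (z + w) = intDot m z + intDot m w := by
  simp [intDot, mul_add, Finset.sum_add_distrib]

theorem intDot_smul {k : ℕ} (m : Fin k → ℤ) (t : ℝ) (z : Fin k → ℝ) :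
    intDot m (t • z) = t * intDot m z := by
  simp [intDot, Finset.mul_sum, mul_left_comm]

theorem intDot_single {k : ℕ} (m : Fin k → ℤ) (i : Fin k) (t : ℝ) :
    intDot m (Pi.single i t) = m i * t := by
  simp [intDot, Pi.single_apply]

theorem character_add {k : ℕ} (m : Fin k → ℤ) (z w : Fin k → ℝ) :
    character m (z + w) = character m z * character m w := by
  simp [character, intDot_add, add_mul, Complex.exp_add]

theorem periodicVec_character {k : ℕ} (m : Fin k → ℤ) : PeriodicVec (character m) := by
  intro z i
  have h : character m (Pi.single i (2 * Real.pi)) = 1 := by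
    rw [character, intDot_single, Complex.exp_eq_one_iff]
    exact ⟨m i, by push_cast; ring⟩
  rw [character_add, h, mul_one]

theorem mFourier_toTorus {k : ℕ} (m : Fin k → ℤ) (z : Fin k → ℝ) :
    UnitAddTorus.mFourier m (toTorus z) = character m z := by
  simp only [UnitAddTorus.mFourier, toTorus, ContinuousMap.coe_mk, fourier_coe_apply, character,
    intDot, ← Complex.exp_sum]
  congr 1
  push_cast
  rw [Finset.sum_mul]
  refine Finset.sum_congr rfl fun i _ => ?_
  have : (Real.pi : ℂ) ≠ 0 := by exact_mod_cast Real.pi_ne_zero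
  field_simp

/-- Trigonometric polynomials are uniformly dense in the continuous periodic functions. -/
theorem exists_trigPoly_approx {k : ℕ} {F : (Fin k → ℝ) → ℂ} (hc : Continuous F)
    (hF : PeriodicVec F) {ε : ℝ} (hε : 0 < ε) :
    ∃ (s : Finset (Fin k → ℤ)) (c : (Fin k → ℤ) → ℂ),
      ∀ z, ‖F z - ∑ m ∈ s, c m * character m z‖ ≤ ε := by
  obtain ⟨g, hg⟩ := exists_torus_lift hc hF
  have hmem : g ∈ closure (Submodule.span ℂ (Set.range
      (UnitAddTorus.mFourier (d := Fin k))) : Set C(UnitAddTorus (Fin k), ℂ)) := by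
    rw [← Submodule.topologicalClosure_coe, UnitAddTorus.span_mFourier_closure_eq_top]
    trivial
  obtain ⟨P, hP, hgP⟩ := Metric.mem_closure_iff.1 hmem ε hε
  obtain ⟨c, rfl⟩ := Finsupp.mem_span_range_iff_exists_finsupp.1 hP
  refine ⟨c.support, c, fun z => ?_⟩
  have h := (ContinuousMap.dist_apply_le_dist (f := g) (toTorus z)).trans hgP.le
  rw [dist_eq_norm, hg] at h
  simpa only [Finsupp.sum, ContinuousMap.coe_sum, Finset.sum_apply, ContinuousMap.coe_smul,
    Pi.smul_apply, mFourier_toTorus, smul_eq_mul] using h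

/-! ### Means along straight lines -/

/-- The mean `lim_{T → ∞} (1/T) ∫₀ᵀ f(θ) dθ` of a complex valued function exists and
equals `a`. -/
def HasComplexMean (f : ℝ → ℂ) (a : ℂ) : Prop :=
  Tendsto (fun T : ℝ => T⁻¹ • ∫ θ in (0 : ℝ)..T, f θ) atTop (𝓝 a)

theorem HasMean.ofReal {f : ℝ → ℝ} {a : ℝ} (h : HasMean f a) :
    HasComplexMean (fun θ => (f θ : ℂ)) a := by
  have := (Complex.continuous_ofReal.tendsto a).comp h
  refine this.congr fun T => ?_
  simp only [Function.comp_apply, intervalIntegral.integral_ofReal, Complex.real_smul,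
    Complex.ofReal_mul]

theorem hasComplexMean_one : HasComplexMean (fun _ => 1) 1 := by
  refine tendsto_const_nhds.congr' ?_
  filter_upwards [eventually_gt_atTop 0] with T hT
  simp [hT.ne']

theorem hasComplexMean_exp {l : ℝ} (hl : l ≠ 0) :
    HasComplexMean (fun θ => Complex.exp (((θ * l : ℝ) : ℂ) * Complex.I)) 0 := by
  have hI : ((l : ℂ) * Complex.I) ≠ 0 :=
    mul_ne_zero (by exact_mod_cast hl) Complex.I_ne_zero
  rw [HasComplexMean, tendsto_zero_iff_norm_tendsto_zero]
  have hlim : Tendsto (fun T : ℝ => T⁻¹ * (2 / |l|)) atTop (𝓝 0) := by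
    simpa using tendsto_inv_atTop_zero.mul_const (2 / |l|)
  refine squeeze_zero' (Eventually.of_forall fun _ => norm_nonneg _) ?_ hlim
  filter_upwards [eventually_gt_atTop 0] with T hT
  have hint : ∫ θ in (0 : ℝ)..T, Complex.exp (((θ * l : ℝ) : ℂ) * Complex.I) =
      (Complex.exp (((l * T : ℝ) : ℂ) * Complex.I) - 1) / (l * Complex.I) := by
    have := integral_exp_mul_complex (a := 0) (b := T) hI
    simp only [Complex.ofReal_zero, mul_zero, Complex.exp_zero] at this
    convert this using 4 <;> push_cast <;> ring_nf
  rw [hint, norm_smul, norm_inv, Real.norm_of_nonneg hT.le, norm_div, norm_mul, Complex.norm_I,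
    mul_one, Complex.norm_real, Real.norm_eq_abs]
  gcongr
  refine (norm_sub_le _ _).trans ?_
  rw [Complex.norm_exp_ofReal_mul_I, norm_one]
  norm_num

theorem HasComplexMean.const_mul {f : ℝ → ℂ} {a : ℂ} (h : HasComplexMean f a) (c : ℂ) :
    HasComplexMean (fun θ => c * f θ) (c * a) := by
  refine (Tendsto.const_mul c h).congr fun T => ?_
  rw [intervalIntegral.integral_const_mul, mul_smul_comm]

theorem HasComplexMean.sum {ι : Type*} {s : Finset ι} {f : ι → ℝ → ℂ} {a : ι → ℂ}
    (hf : ∀ i ∈ s, Continuous (f i)) (h : ∀ i ∈ s, HasComplexMean (f i) (a i)) :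
    HasComplexMean (fun θ => ∑ i ∈ s, f i θ) (∑ i ∈ s, a i) := by
  refine (tendsto_finsetSum s h).congr fun T => ?_
  rw [intervalIntegral.integral_finsetSum fun i hi => (hf i hi).intervalIntegrable _ _,
    Finset.smul_sum]

/-- The mean of an exponential polynomial is the coefficient of its zero frequency. -/
theorem hasComplexMean_expSum {ι : Type*} (s : Finset ι) (b : ι → ℂ) (l : ι → ℝ) :
    HasComplexMean (fun θ => ∑ i ∈ s, b i * Complex.exp (((θ * l i : ℝ) : ℂ) * Complex.I))
      (∑ i ∈ s, if l i = 0 then b i else 0) := by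
  refine HasComplexMean.sum (fun i _ => by fun_prop) fun i _ => ?_
  split_ifs with h
  · simpa [h] using hasComplexMean_one.const_mul (b i)
  · simpa using (hasComplexMean_exp h).const_mul (b i)

theorem HasComplexMean.norm_sub_le {u v : ℝ → ℂ} {a b : ℂ} (hu : HasComplexMean u a)
    (hv : HasComplexMean v b) (hcu : Continuous u) (hcv : Continuous v) {ε : ℝ}
    (h : ∀ θ, ‖u θ - v θ‖ ≤ ε) : ‖a - b‖ ≤ ε := by
  refine le_of_tendsto (hu.sub hv).norm ?_
  filter_upwards [eventually_gt_atTop 0] with T hT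
  rw [← smul_sub, ← intervalIntegral.integral_sub (hcu.intervalIntegrable _ _)
    (hcv.intervalIntegrable _ _), norm_smul, norm_inv, Real.norm_of_nonneg hT.le,
    inv_mul_le_iff₀ hT]
  have := intervalIntegral.norm_integral_le_of_norm_le_const (a := 0) (b := T)
    (f := fun θ => u θ - v θ) (C := ε) fun θ _ => h θ
  rwa [sub_zero, abs_of_pos hT, mul_comm] at this

/-- Off resonance the mean of a continuous periodic function along the lines of direction `ν`
does not depend on the line. -/
theorem HasComplexMean.eq_of_nonresonant {k : ℕ} {F : (Fin k → ℝ) → ℂ} (hc : Continuous F)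
    (hF : PeriodicVec F) {ν : Fin k → ℝ} (hν : Nonresonant ν) {z w : Fin k → ℝ} {a b : ℂ}
    (ha : HasComplexMean (fun θ => F (z + θ • ν)) a)
    (hb : HasComplexMean (fun θ => F (w + θ • ν)) b) : a = b := by
  have key : ∀ ε > 0, ‖a - b‖ ≤ ε + ε := by
    intro ε hε
    obtain ⟨s, c, hs⟩ := exists_trigPoly_approx hc hF hε
    have main : ∀ (y : Fin k → ℝ) (x : ℂ), HasComplexMean (fun θ => F (y + θ • ν)) x →
        ‖x - ∑ m ∈ s, if m = 0 then c m else 0‖ ≤ ε := by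
      intro y x hx
      have hQ := hasComplexMean_expSum s (fun m => c m * character m y) (fun m => intDot m ν)
      have hlim : (∑ m ∈ s, if intDot m ν = 0 then c m * character m y else 0) =
          ∑ m ∈ s, if m = 0 then c m else 0 := by
        refine Finset.sum_congr rfl fun m _ => ?_
        by_cases hm : m = 0
        · subst hm
          simp [intDot, character]
        · rw [if_neg hm, if_neg fun h => hm (hν m h)]
      rw [hlim] at hQ
      refine hx.norm_sub_le hQ (by fun_prop) (by fun_prop) fun θ => ?_
      have := hs (y + θ • ν)
      simp only [character_add, ← mul_assoc] at this
      simpa only [character, intDot_smul] using this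
    calc ‖a - b‖ ≤ ‖a - ∑ m ∈ s, if m = 0 then c m else 0‖ +
          ‖(∑ m ∈ s, if m = 0 then c m else 0) - b‖ := norm_sub_le_norm_sub_add_norm_sub _ _ _
      _ ≤ ε + ε := by
        gcongr
        · exact main z a ha
        · rw [norm_sub_rev]
          exact main w b hb
  rw [← sub_eq_zero, ← norm_le_zero_iff]
  refine le_of_forall_pos_le_add fun ε hε => ?_
  have := key (ε / 2) (by positivity)
  linarith

/-- The only frequencies `μ` for which `θ ↦ exp(iμθ)` is quasiperiodic with tune vector `ν` are
the integer combinations of the entries of `ν`. -/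
theorem exists_intDot_eq_of_quasiperiodic {k : ℕ} {F : (Fin k → ℝ) → ℂ} (hc : Continuous F)
    (hF : PeriodicVec F) {ν : Fin k → ℝ} {a : ℂ} (ha : a ≠ 0) {μ : ℝ}
    (h : ∀ θ : ℝ, F (θ • ν) = a * Complex.exp (((θ * μ : ℝ) : ℂ) * Complex.I)) :
    ∃ m : Fin k → ℤ, intDot m ν = μ := by
  by_contra! hne
  -- A trigonometric polynomial within `‖a‖ / 2` of `F` would, after division by `exp(iμθ)`, have
  -- mean `0` along the orbit while staying within `‖a‖ / 2` of the constant `a`.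
  obtain ⟨s, c, hs⟩ := exists_trigPoly_approx hc hF (half_pos (norm_pos_iff.2 ha))
  have hQ := hasComplexMean_expSum s c (fun m => intDot m ν - μ)
  have hlim : (∑ m ∈ s, if intDot m ν - μ = 0 then c m else 0) = 0 :=
    Finset.sum_eq_zero fun m _ => if_neg (sub_ne_zero.2 (hne m))
  rw [hlim] at hQ
  have hA : HasComplexMean (fun _ => a * 1) (a * 1) := hasComplexMean_one.const_mul a
  have := hA.norm_sub_le hQ (by fun_prop) (by fun_prop) (ε := ‖a‖ / 2) fun θ => by
    have h1 := hs (θ • ν)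
    rw [h, ← one_mul ‖_‖, ← Complex.norm_exp_ofReal_mul_I (-(θ * μ)), ← norm_mul, mul_sub,
      Finset.mul_sum] at h1
    convert h1 using 3
    · rw [mul_left_comm, ← Complex.exp_add]
      simp
    · refine Finset.sum_congr rfl fun m _ => ?_
      rw [mul_left_comm, character, intDot_smul, ← Complex.exp_add]
      push_cast
      ring_nf
  rw [mul_one, sub_zero] at this
  linarith [norm_pos_iff.2 ha]

/-! ### Fields on the extended torus and their orbit derivative -/

variable {d : ℕ}

/-- A function of `(θ, φ) ∈ ℝ × ℝᵈ` as a function on `ℝ^{d+1}`, with `θ` as coordinate `0`. -/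
def joint {X : Type} (f : ℝ → (Fin d → ℝ) → X) (z : Fin (d + 1) → ℝ) : X :=
  f (z 0) (Fin.tail z)

theorem periodicVec_joint {X : Type} {f : ℝ → (Fin d → ℝ) → X} (hθ : PeriodicTheta f)
    (hφ : PeriodicPhi f) : PeriodicVec (joint f) := by
  intro z i
  refine Fin.cases ?_ (fun j => ?_) i
  · have : Fin.tail (z + Pi.single 0 (2 * Real.pi)) = Fin.tail z := by
      ext l
      simp [Fin.tail]
    simp only [joint, this, Pi.add_apply, Pi.single_eq_same]
    exact hθ _ _
  · have : Fin.tail (z + Pi.single j.succ (2 * Real.pi)) =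
        Fin.tail z + Pi.single j (2 * Real.pi) := by
      ext l
      simp [Fin.tail, Pi.single_apply]
    have h0 : (z + (Pi.single j.succ (2 * Real.pi) : Fin (d + 1) → ℝ)) 0 = z 0 := by
      simp
    simp only [joint, this, h0]
    exact hφ _ _ _

theorem contDiff_joint {r : ℕ} {f : ℝ → (Fin d → ℝ) → ℝ} (hf : IsCr r f) :
    ContDiff ℝ r (joint f) := by
  have h : ContDiff ℝ r fun z : Fin (d + 1) → ℝ => (z 0, Fin.tail z) :=
    (contDiff_apply ℝ ℝ 0).prodMk (contDiff_pi.2 fun i => contDiff_apply ℝ ℝ i.succ)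
  exact ContDiff.comp hf h

theorem continuous_joint {f : ℝ → (Fin d → ℝ) → ℝ} (hf : IsCr 0 f) : Continuous (joint f) :=
  (contDiff_joint hf).continuous

theorem joint_orbit {X : Type} (f : ℝ → (Fin d → ℝ) → X) (ω φ₀ : Fin d → ℝ) (θ : ℝ) :
    joint f (Fin.cons 0 φ₀ + θ • tuneVec ω) = f θ (θ • ω + φ₀) := by
  have h : Fin.tail ((Fin.cons 0 φ₀ : Fin (d + 1) → ℝ) + θ • tuneVec ω) = θ • ω + φ₀ := by
    ext l
    simp [Fin.tail, tuneVec, add_comm]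
  simp only [joint, h]
  simp [tuneVec]

theorem IsCr.of_le {r n : ℕ} {f : ℝ → (Fin d → ℝ) → ℝ} (hf : IsCr r f) (h : n ≤ r) : IsCr n f :=
  ContDiff.of_le hf (by exact_mod_cast h)

theorem isCr_DD {n : ℕ} {f : ℝ → (Fin d → ℝ) → ℝ} (ω : Fin d → ℝ) (hf : IsCr (n + 1) f) :
    IsCr n (DD ω f) := by
  have h := ContDiff.fderiv_right (m := n) hf (by push_cast; exact le_rfl)
  exact h.clm_apply contDiff_const

theorem isCr_CC {n : ℕ} {A V : MatField d} (ω : Fin d → ℝ) (hA : A.IsCr n)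
    (hV : V.IsCr (n + 1)) : IsCr n (CC A ω V) := by
  have hA' : ∀ i j, ContDiff ℝ n fun p : ℝ × (Fin d → ℝ) => A p.1 p.2 i j := hA
  have hV' : ∀ i j, ContDiff ℝ n fun p : ℝ × (Fin d → ℝ) => V p.1 p.2 i j :=
    fun i j => (hV i j).of_le n.le_succ
  have hD : ∀ i j, ContDiff ℝ n
      fun p : ℝ × (Fin d → ℝ) => DD ω (fun t x => V t x i j) p.1 p.2 :=
    fun i j => isCr_DD ω (hV i j)
  unfold IsCr
  simp only [CC, Matrix.trace, Matrix.diag_apply, Matrix.mul_apply, Matrix.sub_apply,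
    Matrix.transpose_apply, DDMat, Matrix.of_apply]
  fun_prop

theorem periodicTheta_DD {f : ℝ → (Fin d → ℝ) → ℝ} (ω : Fin d → ℝ) (hf : PeriodicTheta f) :
    PeriodicTheta (DD ω f) := by
  intro θ φ
  have h := fderiv_comp_add_right (𝕜 := ℝ) (f := fun p : ℝ × (Fin d → ℝ) => f p.1 p.2)
    (x := (θ, φ)) ((2 * Real.pi, 0) : ℝ × (Fin d → ℝ))
  simp only [Prod.fst_add, Prod.snd_add, add_zero, hf _ _, Prod.mk_add_mk] at h
  simp only [DD, h]

theorem periodicPhi_DD {f : ℝ → (Fin d → ℝ) → ℝ} (ω : Fin d → ℝ) (hf : PeriodicPhi f) :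
    PeriodicPhi (DD ω f) := by
  intro θ φ i
  have h := fderiv_comp_add_right (𝕜 := ℝ) (f := fun p : ℝ × (Fin d → ℝ) => f p.1 p.2)
    (x := (θ, φ)) ((0, Pi.single i (2 * Real.pi)) : ℝ × (Fin d → ℝ))
  simp only [Prod.fst_add, Prod.snd_add, add_zero, hf _ _, Prod.mk_add_mk] at h
  simp only [DD, h]

theorem periodicTheta_CC {A V : MatField d} (ω : Fin d → ℝ) (hA : PeriodicTheta A)
    (hV : PeriodicTheta V) : PeriodicTheta (CC A ω V) := by
  intro θ φ
  have hD : DDMat ω V (θ + 2 * Real.pi) φ = DDMat ω V θ φ := by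
    ext i j
    exact periodicTheta_DD ω (f := fun t x => V t x i j) (fun t x => by simp only [hV t x]) θ φ
  simp only [CC, hA θ φ, hV θ φ, hD]

theorem periodicPhi_CC {A V : MatField d} (ω : Fin d → ℝ) (hA : PeriodicPhi A)
    (hV : PeriodicPhi V) : PeriodicPhi (CC A ω V) := by
  intro θ φ l
  have hD : DDMat ω V θ (φ + Pi.single l (2 * Real.pi)) = DDMat ω V θ φ := by
    ext i j
    exact periodicPhi_DD ω (f := fun t x => V t x i j) (fun t x l => by simp only [hV t x l])
      θ φ l
  simp only [CC, hA θ φ l, hV θ φ l, hD]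

/-- `𝒟` is the derivative along the orbits `θ ↦ (θ, ωθ + φ₀)`. -/
theorem hasDerivAt_orbit {f : ℝ → (Fin d → ℝ) → ℝ} (hf : IsCr 1 f) (ω φ₀ : Fin d → ℝ) (θ : ℝ) :
    HasDerivAt (fun t => f t (t • ω + φ₀)) (DD ω f θ (θ • ω + φ₀)) θ := by
  have hd : DifferentiableAt ℝ (fun p : ℝ × (Fin d → ℝ) => f p.1 p.2) (θ, θ • ω + φ₀) :=
    (ContDiff.differentiable hf (by norm_num)).differentiableAt
  have hl : HasDerivAt (fun t : ℝ => t • ω + φ₀) ω θ := by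
    simpa using ((hasDerivAt_id θ).smul_const ω).add_const φ₀
  exact hd.hasFDerivAt.comp_hasDerivAt θ ((hasDerivAt_id θ).prodMk hl)

theorem hasDerivAt_orbit_matrix {V : MatField d} (hV : V.IsCr 1) (ω φ₀ : Fin d → ℝ) (θ : ℝ)
    (i j : Fin 3) :
    HasDerivAt (fun t => V t (t • ω + φ₀) i j) (DDMat ω V θ (θ • ω + φ₀) i j) θ :=
  hasDerivAt_orbit (hV i j) ω φ₀ θ

/-! ### The spin equation in an invariant frame -/

/-- A skew-symmetric matrix with vanishing third column is a multiple of `𝒥`. -/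
theorem eq_smul_JJ {W : M3} (hW : Wᵀ = -W) (h2 : ∀ i, W i 2 = 0) :
    W = (-(1 / 2) * (JJ * W).trace) • JJ := by
  have h : ∀ i j, W j i = -W i j := fun i j => by simpa using congrFun (congrFun hW i) j
  have ht : (JJ * W).trace = W 0 1 - W 1 0 := by
    simp only [Matrix.trace, Matrix.diag_apply, Matrix.mul_apply, Fin.sum_univ_three]
    simp [JJ]
    ring
  rw [ht]
  have h00 := h 0 0
  have h11 := h 1 1
  have h01 := h 0 1
  have h20 := h 0 2
  have h21 := h 1 2
  have e0 := h2 0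
  have e1 := h2 1
  have e2 := h2 2
  ext i j
  fin_cases i <;> fin_cases j <;>
    simp [JJ] <;> linarith

/-- In an orthonormal frame whose third column solves the spin equation, the spin equation
reduces to a rotation about the third axis at the rate `𝒞_𝒱`. -/
theorem DDMat_frame {A V : MatField d} {ω : Fin d → ℝ} (hA : ∀ θ φ, (A θ φ)ᵀ = -A θ φ)
    (hV : IsFrameField A ω V) (θ : ℝ) (φ : Fin d → ℝ) :
    DDMat ω V θ φ = A θ φ * V θ φ - CC A ω V θ φ • (V θ φ * JJ) := by
  obtain ⟨hSO, hC, -, -, -, hS⟩ := hV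
  set D := DDMat ω V θ φ with hD
  -- Differentiate `𝒱ᵀ𝒱 = 1` along the orbit through `(θ, φ)`.
  have hskew : Dᵀ * V θ φ + (V θ φ)ᵀ * D = 0 := by
    ext i j
    have hφ : θ • ω + (φ - θ • ω) = φ := by abel
    have h1 : ∀ i j, HasDerivAt (fun t => V t (t • ω + (φ - θ • ω)) i j) (D i j) θ := by
      intro i j
      have := hasDerivAt_orbit_matrix hC ω (φ - θ • ω) θ i j
      rwa [hφ] at this
    have h2 := hasDerivAt_matrix_mul (P := fun t => (V t (t • ω + (φ - θ • ω)))ᵀ) (P' := Dᵀ)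
      (fun i j => h1 j i) h1 i j
    simp only [(hSO _ _).transpose_mul, hφ] at h2
    exact h2.unique (hasDerivAt_const _ _)
  have hW := eq_smul_JJ (W := (V θ φ)ᵀ * A θ φ * V θ φ - (V θ φ)ᵀ * D) (by
    simp only [Matrix.transpose_sub, Matrix.transpose_mul, Matrix.transpose_transpose, hA,
      eq_neg_of_add_eq_zero_left hskew]
    simp only [neg_mul, mul_neg, mul_assoc]
    abel) (fun i => by
    have hz : ∀ l, (A θ φ * V θ φ - D) l 2 = 0 := by
      intro l
      have := hS θ φ l
      simp only [Matrix.sub_apply, hD, DDMat, Matrix.of_apply, this, Matrix.mul_apply,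
        Matrix.mulVec, dotProduct, sub_self]
    rw [mul_assoc, ← mul_sub, Matrix.mul_apply]
    exact Finset.sum_eq_zero fun l _ => by rw [hz, mul_zero])
  have hCC : CC A ω V θ φ = -(1 / 2) * (JJ * ((V θ φ)ᵀ * A θ φ * V θ φ - (V θ φ)ᵀ * D)).trace :=
    rfl
  rw [← hCC] at hW
  have := congrArg (fun M => V θ φ * M) hW
  simp only [mul_sub, ← mul_assoc, (hSO θ φ).mul_transpose, one_mul, Matrix.mul_smul] at this
  rw [← this]
  abel

/-- Conversely, an orthonormal frame rotating at the constant rate `ν` has `𝒞 = ν`. -/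
theorem CC_eq_of_DDMat {A U : MatField d} {ω : Fin d → ℝ} {θ ν : ℝ} {φ : Fin d → ℝ}
    (hU : IsSO3 (U θ φ)) (h : DDMat ω U θ φ = A θ φ * U θ φ - ν • (U θ φ * JJ)) :
    CC A ω U θ φ = ν := by
  have h1 : (U θ φ)ᵀ * A θ φ * U θ φ - (U θ φ)ᵀ * DDMat ω U θ φ = ν • JJ := by
    rw [h, mul_sub, Matrix.mul_smul, ← mul_assoc, ← mul_assoc, hU.transpose_mul, one_mul]
    abel
  rw [CC, h1]
  simp [JJ, Matrix.trace, Fin.sum_univ_three]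
  ring

/-- A frame field followed by a rotation about the third axis whose angle `β` has the rate
`c_𝒱 - ν` rotates at the rate `ν` along the orbit. -/
theorem hasDerivAt_rotated_frame {A V : MatField d} {ω φ₀ : Fin d → ℝ}
    (hA : ∀ θ φ, (A θ φ)ᵀ = -A θ φ) (hV : IsFrameField A ω V) {β : ℝ → ℝ} {ν θ : ℝ}
    (hβ : HasDerivAt β (cV A ω V φ₀ θ - ν) θ) (i j : Fin 3) :
    HasDerivAt (fun t => (V t (t • ω + φ₀) * expJ (β t)) i j)
      ((A θ (θ • ω + φ₀) * (V θ (θ • ω + φ₀) * expJ (β θ)) -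
        ν • (V θ (θ • ω + φ₀) * expJ (β θ) * JJ)) i j) θ := by
  have h1 := fun i j => hasDerivAt_orbit_matrix hV.2.1 ω φ₀ θ i j
  rw [DDMat_frame hA hV] at h1
  have h2 : ∀ i j, HasDerivAt (fun t => expJ (β t) i j)
      (((cV A ω V φ₀ θ - ν) • (JJ * expJ (β θ))) i j) θ := by
    intro i j
    have := (hasDerivAt_expJ_apply (β θ) i j).comp θ hβ
    rwa [mul_comm] at this
  have h3 := hasDerivAt_matrix_mul h1 h2 i j
  refine h3.congr_deriv (congrFun (congrFun ?_ i) j)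
  simp only [JJ_mul_expJ, cV, sub_mul, mul_sub, Matrix.mul_smul, Matrix.smul_mul, mul_assoc,
    sub_smul]
  abel

/-- Composing such a frame with `exp(𝒥νθ)` cancels its rotation, which leaves a solution of the
spin equation. -/
theorem isUPF_rotated_frame {A V : MatField d} {ω φ₀ : Fin d → ℝ}
    (hA : ∀ θ φ, (A θ φ)ᵀ = -A θ φ) (hV : IsFrameField A ω V) {β : ℝ → ℝ} {ν : ℝ}
    (hν : ν ∈ Set.Ico (0 : ℝ) 1) (hβ : ∀ θ, HasDerivAt β (cV A ω V φ₀ θ - ν) θ) :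
    IsUPF A ω φ₀ (fun θ => V θ (θ • ω + φ₀) * expJ (β θ)) ν := by
  have hSO : ∀ θ, IsSO3 (V θ (θ • ω + φ₀) * expJ (β θ)) :=
    fun θ => (hV.1 _ _).mul (isSO3_expJ _)
  refine ⟨hSO, hν, fun θ i j => ?_, ?_⟩
  · have h1 := fun i j => hasDerivAt_rotated_frame hA hV (hβ θ) i j
    have h2 : ∀ i j, HasDerivAt (fun t => expJ (ν * t) i j) ((ν • (JJ * expJ (ν * θ))) i j) θ := by
      intro i j
      have hl : HasDerivAt (fun t => ν * t) ν θ := by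
        simpa using (hasDerivAt_id θ).const_mul ν
      have := (hasDerivAt_expJ_apply (ν * θ) i j).comp θ hl
      rwa [mul_comm] at this
    have h3 := hasDerivAt_matrix_mul
      (fun i j => hasDerivAt_matrix_mul h1 h2 i j)
      (Q := fun _ => (V 0 ((0 : ℝ) • ω + φ₀) * expJ (β 0))ᵀ) (Q' := 0)
      (fun i j => hasDerivAt_const _ _) i j
    refine h3.congr_deriv (congrFun (congrFun ?_ i) j)
    simp only [sub_mul, Matrix.mul_smul, Matrix.smul_mul, mul_assoc, mul_zero, add_zero,
      sub_add_cancel]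
    rfl
  · simp only [mul_zero, expJ_zero, mul_one]
    exact (hSO 0).mul_transpose

/-! ### Straightening a frame field along one orbit -/

/-- If `f - c` has a bounded primitive then `f` has the mean `c`. -/
theorem hasMean_of_bounded_primitive {f u : ℝ → ℝ} {c C : ℝ} (hf : Continuous f)
    (hu : ∀ θ, HasDerivAt u (f θ - c) θ) (hC : ∀ θ, |u θ| ≤ C) : HasMean f c := by
  have hint : ∀ T : ℝ, ∫ θ in (0 : ℝ)..T, f θ = u T - u 0 + T * c := by
    intro T
    have h := intervalIntegral.integral_eq_sub_of_hasDerivAt (a := 0) (b := T)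
      (fun θ _ => hu θ) ((by fun_prop : Continuous fun θ => f θ - c).intervalIntegrable _ _)
    rw [intervalIntegral.integral_sub (hf.intervalIntegrable _ _)
      (continuous_const.intervalIntegrable _ _), intervalIntegral.integral_const, sub_zero,
      smul_eq_mul] at h
    linarith
  have hz : Tendsto (fun T : ℝ => T⁻¹ * (u T - u 0)) atTop (𝓝 0) := by
    have hlim : Tendsto (fun T : ℝ => T⁻¹ * (2 * C)) atTop (𝓝 0) := by
      simpa using tendsto_inv_atTop_zero.mul_const (2 * C)
    rw [tendsto_zero_iff_abs_tendsto_zero]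
    refine squeeze_zero' (Eventually.of_forall fun _ => abs_nonneg _) ?_ hlim
    filter_upwards [eventually_gt_atTop 0] with T hT
    rw [Function.comp_apply, abs_mul, abs_of_pos (inv_pos.2 hT)]
    gcongr
    have := abs_sub (u T) (u 0)
    linarith [hC T, hC 0]
  have := hz.add_const c
  rw [zero_add] at this
  refine this.congr' ?_
  filter_upwards [eventually_gt_atTop 0] with T hT
  rw [hint, mul_add, inv_mul_cancel_left₀ hT.ne']

theorem continuous_cV {A V : MatField d} {ω : Fin d → ℝ} (hA : IsSpinSystem A)
    (hV : IsFrameField A ω V) (φ₀ : Fin d → ℝ) : Continuous (cV A ω V φ₀) := by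
  have h := continuous_joint (isCr_CC (n := 0) ω (fun i j => (hA.smooth i j).of_le zero_le_one)
    hV.2.1)
  have h' : Continuous fun θ : ℝ => (Fin.cons 0 φ₀ : Fin (d + 1) → ℝ) + θ • tuneVec ω := by
    fun_prop
  have h2 := h.comp h'
  simp only [Function.comp_def, joint_orbit] at h2
  exact h2

theorem bounded_on_orbit {α : ℝ → (Fin d → ℝ) → ℝ} (hα : IsCr 1 α) (hθ : PeriodicTheta α)
    (hφ : PeriodicPhi α) (ω φ₀ : Fin d → ℝ) : ∃ C, ∀ θ : ℝ, |α θ (θ • ω + φ₀)| ≤ C := by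
  have hp := periodicVec_joint hθ hφ
  obtain ⟨C, hC⟩ := PeriodicVec.exists_bound (F := Complex.ofReal ∘ joint α)
    (Complex.continuous_ofReal.comp (contDiff_joint hα).continuous)
    (fun z i => congrArg Complex.ofReal (hp z i))
  refine ⟨C, fun θ => ?_⟩
  have := hC (Fin.cons 0 φ₀ + θ • tuneVec ω)
  rwa [Function.comp_apply, Complex.norm_real, joint_orbit, Real.norm_eq_abs] at this

/-- A `C¹` periodic solution of `𝒟α = 𝒞_𝒱 - c` along the orbit of `φ₀` forces `c_𝒱(·; φ₀)` to
have the mean `c`. -/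
theorem hasMean_cV {A V : MatField d} {ω : Fin d → ℝ} (hA : IsSpinSystem A)
    (hV : IsFrameField A ω V) {α : ℝ → (Fin d → ℝ) → ℝ} (hα : IsCr 1 α) (hθ : PeriodicTheta α)
    (hφ : PeriodicPhi α) {φ₀ : Fin d → ℝ} {c : ℝ}
    (h : ∀ θ : ℝ, DD ω α θ (θ • ω + φ₀) = cV A ω V φ₀ θ - c) : HasMean (cV A ω V φ₀) c := by
  obtain ⟨C, hC⟩ := bounded_on_orbit hα hθ hφ ω φ₀
  exact hasMean_of_bounded_primitive (continuous_cV hA hV φ₀)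
    (fun θ => h θ ▸ hasDerivAt_orbit hα ω φ₀ θ) hC

theorem SolvesCohomological.DD_orbit {A V : MatField d} {ω : Fin d → ℝ}
    {α : ℝ → (Fin d → ℝ) → ℝ} (h : SolvesCohomological A ω V α) (φ₀ : Fin d → ℝ) (θ : ℝ) :
    DD ω α θ (θ • ω + φ₀) = cV A ω V φ₀ θ - cBar A ω V φ₀ := by
  rw [h.2.2.2, add_sub_cancel_left, cTilde]

theorem UFrame_eq (A : MatField d) (ω : Fin d → ℝ) (V : MatField d) (α : ℝ → (Fin d → ℝ) → ℝ)
    (φ₀ : Fin d → ℝ) (θ : ℝ) :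
    UFrame A ω V α φ₀ θ =
      V θ (θ • ω + φ₀) * expJ (α θ (θ • ω + φ₀) + (kV A ω V φ₀ : ℝ) * θ) := by
  rw [UFrame, UU, add_sub_cancel_left]

/-- Along an orbit, the angle `α + k_𝒱 θ` has the rate `c_𝒱 - ν_𝒱`. -/
theorem SolvesCohomological.hasDerivAt_angle {A V : MatField d} {ω : Fin d → ℝ}
    {α : ℝ → (Fin d → ℝ) → ℝ} (h : SolvesCohomological A ω V α) (φ₀ : Fin d → ℝ) (θ : ℝ) :
    HasDerivAt (fun t => α t (t • ω + φ₀) + (kV A ω V φ₀ : ℝ) * t)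
      (cV A ω V φ₀ θ - nuV A ω V φ₀) θ := by
  have h1 := hasDerivAt_orbit h.1 ω φ₀ θ
  rw [h.DD_orbit] at h1
  have h2 := h1.add ((hasDerivAt_id θ).const_mul (kV A ω V φ₀ : ℝ))
  refine h2.congr_deriv ?_
  rw [nuV, kV, Int.fract]
  ring

/-- Straightening an invariant frame field along an orbit gives a proper uniform precession
frame; it is quasiperiodic because `k_𝒱(φ₀)` is an integer. -/
theorem isProperUPF_UFrame {A V : MatField d} {ω : Fin d → ℝ} {α : ℝ → (Fin d → ℝ) → ℝ}
    (hA : IsSpinSystem A) (hV : IsIFF A ω V) (h : SolvesCohomological A ω V α)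
    (φ₀ : Fin d → ℝ) : IsProperUPF A ω φ₀ (UFrame A ω V α φ₀) (nuV A ω V φ₀) := by
  constructor
  · rw [show UFrame A ω V α φ₀ = _ from funext (UFrame_eq A ω V α φ₀)]
    exact isUPF_rotated_frame hA.skew hV.1 ⟨Int.fract_nonneg _, Int.fract_lt_one _⟩
      (h.hasDerivAt_angle φ₀)
  · intro i j
    let f : ℝ → (Fin d → ℝ) → ℝ := fun t x =>
      (V t (x + φ₀) * expJ (α t (x + φ₀) + (kV A ω V φ₀ : ℝ) * t)) i j
    have hf : IsCr 0 f := by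
      have hs : ContDiff ℝ 0 fun p : ℝ × (Fin d → ℝ) => (p.1, p.2 + φ₀) := by fun_prop
      have h1 : ∀ i j, ContDiff ℝ 0 fun p : ℝ × (Fin d → ℝ) => V p.1 (p.2 + φ₀) i j :=
        fun i j => ContDiff.comp ((hV.1.2.1 i j).of_le zero_le_one) hs
      have h2 : ContDiff ℝ 0 fun p : ℝ × (Fin d → ℝ) => α p.1 (p.2 + φ₀) :=
        ContDiff.comp (h.1.of_le zero_le_one) hs
      have h3 : ∀ i j, ContDiff ℝ 0 fun p : ℝ × (Fin d → ℝ) =>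
          expJ (α p.1 (p.2 + φ₀) + (kV A ω V φ₀ : ℝ) * p.1) i j := fun i j =>
        (contDiff_expJ_apply i j).comp (h2.add (contDiff_const.mul contDiff_fst))
      simp only [IsCr, f, Matrix.mul_apply]
      exact ContDiff.sum fun l _ => (h1 i l).mul (h3 l j)
    have hθ : PeriodicTheta f := by
      intro t x
      simp only [f, hV.2 _ _, h.2.1 _ _, mul_add, ← add_assoc, expJ_add_int]
    have hφ : PeriodicPhi f := by
      intro t x l
      simp only [f, add_right_comm _ (Pi.single _ _), hV.1.2.2.1 _ _ _, h.2.2.1 _ _ _]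
    refine ⟨joint f, continuous_joint hf, periodicVec_joint hθ hφ, fun θ => ?_⟩
    have := joint_orbit f ω 0 θ
    have hz : (Fin.cons 0 (0 : Fin d → ℝ) : Fin (d + 1) → ℝ) = 0 :=
      funext fun l => Fin.cases rfl (fun _ => rfl) l
    rw [hz, zero_add] at this
    rw [this, add_zero]
    exact congrFun (congrFun (UFrame_eq A ω V α φ₀ θ) i) j

/-! ### Equivalence of the proper precession rates -/

/-- Two orthogonal solutions of the spin equation with the same initial value coincide. -/
theorem IsPrincipalSolution.unique {A : MatField d} {ω φ₀ : Fin d → ℝ}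
    (hA : ∀ θ φ, (A θ φ)ᵀ = -A θ φ) {Φ Ψ : ℝ → M3} (hΦ : IsPrincipalSolution A ω φ₀ Φ)
    (hΨ : IsPrincipalSolution A ω φ₀ Ψ) (hSO : ∀ θ, IsSO3 (Φ θ)) (θ : ℝ) : Φ θ = Ψ θ := by
  -- `ΦᵀΨ` is constant because `𝒜` is skew-symmetric.
  have hd : ∀ i j t, HasDerivAt (fun s => ((Φ s)ᵀ * Ψ s) i j) 0 t := by
    intro i j t
    have h := hasDerivAt_matrix_mul (P := fun s => (Φ s)ᵀ)
      (P' := (A t (t • ω + φ₀) * Φ t)ᵀ) (fun i j => hΦ.1 t j i) (hΨ.1 t) i j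
    refine h.congr_deriv ?_
    rw [Matrix.transpose_mul, hA, mul_neg, neg_mul, ← mul_assoc, neg_add_cancel,
      Matrix.zero_apply]
  have h1 : (Φ θ)ᵀ * Ψ θ = 1 := by
    ext i j
    rw [is_const_of_deriv_eq_zero (fun t => (hd i j t).differentiableAt)
      (fun t => (hd i j t).deriv) θ 0, hΦ.2, hΨ.2, Matrix.transpose_one, one_mul]
  calc Φ θ = Φ θ * ((Φ θ)ᵀ * Ψ θ) := by rw [h1, mul_one]
    _ = Ψ θ := by rw [← mul_assoc, (hSO θ).mul_transpose, one_mul]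

theorem IsSO3.transpose {P : M3} (hP : IsSO3 P) : IsSO3 Pᵀ := by
  have h := hP
  rw [IsSO3, Matrix.mem_specialOrthogonalGroup_iff] at h ⊢
  refine ⟨?_, by rw [Matrix.det_transpose]; exact h.2⟩
  rw [Matrix.mem_orthogonalGroup_iff']
  exact (Matrix.transpose_transpose P).symm ▸ hP.mul_transpose

/-- Two uniform precession frames at the same `φ₀` differ by a constant rotation, conjugated by
the uniform precessions. -/
theorem IsUPF.transpose_mul {A : MatField d} {ω φ₀ : Fin d → ℝ}
    (hA : ∀ θ φ, (A θ φ)ᵀ = -A θ φ) {U₁ U₂ : ℝ → M3} {ν₁ ν₂ : ℝ} (h₁ : IsUPF A ω φ₀ U₁ ν₁)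
    (h₂ : IsUPF A ω φ₀ U₂ ν₂) (θ : ℝ) :
    (U₁ θ)ᵀ * U₂ θ = expJ (ν₁ * θ) * ((U₁ 0)ᵀ * U₂ 0) * expJ (-(ν₂ * θ)) := by
  have h := h₁.2.2.unique hA h₂.2.2
    (fun t => ((h₁.1 t).mul (isSO3_expJ _)).mul (h₁.1 0).transpose) θ
  have e1 := (h₁.1 θ).transpose_mul
  have e2 := (h₂.1 0).transpose_mul
  have e3 : expJ (ν₂ * θ) * expJ (-(ν₂ * θ)) = 1 := by
    rw [← expJ_add, add_neg_cancel, expJ_zero]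
  calc (U₁ θ)ᵀ * U₂ θ
      = (U₁ θ)ᵀ * (U₂ θ * expJ (ν₂ * θ) * (U₂ 0)ᵀ) * U₂ 0 * expJ (-(ν₂ * θ)) := by
        simp only [mul_assoc]
        rw [← mul_assoc (U₂ 0)ᵀ, e2, one_mul, e3, mul_one]
    _ = (U₁ θ)ᵀ * (U₁ θ * expJ (ν₁ * θ) * (U₁ 0)ᵀ) * U₂ 0 * expJ (-(ν₂ * θ)) := by rw [h]
    _ = _ := by
        simp only [← mul_assoc]
        rw [e1, one_mul]

/-- The rotation part of the upper left `2 × 2` block, as a complex number. -/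
def rotPart (P : M3) : ℂ := ((P 0 0 + P 1 1 : ℝ) : ℂ) + ((P 1 0 - P 0 1 : ℝ) : ℂ) * Complex.I

/-- The reflection part of the upper left `2 × 2` block, as a complex number. -/
def reflPart (P : M3) : ℂ := ((P 0 0 - P 1 1 : ℝ) : ℂ) + ((P 1 0 + P 0 1 : ℝ) : ℂ) * Complex.I

theorem rotPart_expJ_mul (a b : ℝ) (M : M3) :
    rotPart (expJ a * M * expJ (-b)) =
      rotPart M * Complex.exp (((a - b : ℝ) : ℂ) * Complex.I) := by
  rw [Complex.exp_mul_I, ← Complex.ofReal_cos, ← Complex.ofReal_sin]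
  simp only [rotPart, Matrix.mul_apply, Fin.sum_univ_three, Real.cos_sub, Real.sin_sub]
  apply Complex.ext <;> simp [expJ_eq] <;> ring

theorem reflPart_expJ_mul (a b : ℝ) (M : M3) :
    reflPart (expJ a * M * expJ (-b)) =
      reflPart M * Complex.exp (((a + b : ℝ) : ℂ) * Complex.I) := by
  rw [Complex.exp_mul_I, ← Complex.ofReal_cos, ← Complex.ofReal_sin]
  simp only [reflPart, Matrix.mul_apply, Fin.sum_univ_three, Real.cos_add, Real.sin_add]
  apply Complex.ext <;> simp [expJ_eq] <;> ring

/-- The upper left `2 × 2` block of a rotation does not vanish. -/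
theorem IsSO3.rotPart_ne_zero_or {M : M3} (hM : IsSO3 M) : rotPart M ≠ 0 ∨ reflPart M ≠ 0 := by
  by_contra! h
  have h1 := congrArg Complex.re h.1
  have h2 := congrArg Complex.im h.1
  have h3 := congrArg Complex.re h.2
  have h4 := congrArg Complex.im h.2
  simp [rotPart, reflPart] at h1 h2 h3 h4
  have a00 : M 0 0 = 0 := by linarith
  have a11 : M 1 1 = 0 := by linarith
  have a10 : M 1 0 = 0 := by linarith
  have a01 : M 0 1 = 0 := by linarith
  have e := hM.transpose_mul
  have e00 := congrFun (congrFun e 0) 0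
  have e01 := congrFun (congrFun e 0) 1
  have e11 := congrFun (congrFun e 1) 1
  simp [Matrix.mul_apply, Fin.sum_univ_three, a00, a01, a10, a11] at e00 e01 e11
  rcases e01 with e01 | e01
  · simp [e01] at e00
  · simp [e01] at e11

theorem intDot_tuneVec (m : Fin (d + 1) → ℤ) (ω : Fin d → ℝ) :
    intDot m (tuneVec ω) = m 0 + intDot (Fin.tail m) ω := by
  simp [intDot, tuneVec, Fin.sum_univ_succ, Fin.tail]

theorem intDot_neg_left {k : ℕ} (m : Fin k → ℤ) (z : Fin k → ℝ) :
    intDot (-m) z = -intDot m z := by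
  simp [intDot]

theorem intDot_add_left {k : ℕ} (m n : Fin k → ℤ) (z : Fin k → ℝ) :
    intDot (m + n) z = intDot m z + intDot n z := by
  simp [intDot, add_mul, Finset.sum_add_distrib]

theorem TuneEquiv.trans {ω : Fin d → ℝ} {a b c : ℝ} (hab : TuneEquiv ω a b)
    (hbc : TuneEquiv ω b c) : TuneEquiv ω a c := by
  obtain ⟨ε, j₀, j, hε, rfl⟩ := hab
  obtain ⟨δ, l₀, l, hδ, rfl⟩ := hbc
  rcases hδ with rfl | rfl
  · refine ⟨ε, j₀ + l₀, j + l, hε, ?_⟩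
    rw [intDot_add_left]
    push_cast
    ring
  · refine ⟨-ε, -j₀ + l₀, -j + l, by rcases hε with rfl | rfl <;> simp, ?_⟩
    rw [intDot_add_left, intDot_neg_left]
    push_cast
    ring

/-- The proper uniform precession rates at a fixed `φ₀` are equivalent: the rotation and
reflection parts of the quasiperiodic `U₁ᵀU₂` are multiples of `exp(i(ν₁ ∓ ν₂)θ)`, and one of them
does not vanish. -/
theorem IsProperUPF.tuneEquiv {A : MatField d} {ω φ₀ : Fin d → ℝ}
    (hA : ∀ θ φ, (A θ φ)ᵀ = -A θ φ) {U₁ U₂ : ℝ → M3} {ν₁ ν₂ : ℝ}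
    (h₁ : IsProperUPF A ω φ₀ U₁ ν₁) (h₂ : IsProperUPF A ω φ₀ U₂ ν₂) : TuneEquiv ω ν₁ ν₂ := by
  choose F₁ hc₁ hp₁ hF₁ using h₁.2
  choose F₂ hc₂ hp₂ hF₂ using h₂.2
  let P : (Fin (d + 1) → ℝ) → M3 := fun z =>
    Matrix.of fun i j => ∑ l, F₁ l i z * F₂ l j z
  have hPc : ∀ i j, Continuous fun z => P z i j := by
    intro i j
    simp only [P, Matrix.of_apply]
    fun_prop
  have hPp : PeriodicVec P := by
    intro z i
    ext a b
    simp only [P, Matrix.of_apply, hp₁ _ _ z i, hp₂ _ _ z i]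
  have hP : ∀ θ : ℝ, P (θ • tuneVec ω) = (U₁ θ)ᵀ * U₂ θ := by
    intro θ
    ext a b
    simp only [P, Matrix.of_apply, Matrix.mul_apply, Matrix.transpose_apply, ← hF₁, ← hF₂]
  have hM : IsSO3 ((U₁ 0)ᵀ * U₂ 0) := (h₁.1.1 0).transpose.mul (h₂.1.1 0)
  rcases hM.rotPart_ne_zero_or with h0 | h0
  · obtain ⟨m, hm⟩ := exists_intDot_eq_of_quasiperiodic (F := fun z => rotPart (P z))
      (by unfold rotPart; fun_prop) (fun z i => congrArg rotPart (hPp z i)) (ν := tuneVec ω)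
      (μ := ν₁ - ν₂) h0 fun θ => by
        simp only [hP, h₁.1.transpose_mul hA h₂.1 θ, rotPart_expJ_mul]
        congr 4
        ring
    rw [intDot_tuneVec] at hm
    refine ⟨1, -m 0, -Fin.tail m, Or.inl rfl, ?_⟩
    rw [intDot_neg_left]
    push_cast
    linarith
  · obtain ⟨m, hm⟩ := exists_intDot_eq_of_quasiperiodic (F := fun z => reflPart (P z))
      (by unfold reflPart; fun_prop) (fun z i => congrArg reflPart (hPp z i)) (ν := tuneVec ω)
      (μ := ν₁ + ν₂) h0 fun θ => by
        simp only [hP, h₁.1.transpose_mul hA h₂.1 θ, reflPart_expJ_mul]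
        congr 4
        ring
    rw [intDot_tuneVec] at hm
    refine ⟨-1, m 0, Fin.tail m, Or.inr rfl, ?_⟩
    linarith

/-- A torus with the same proper uniform precession rate at every `φ₀` is well-tuned. -/
theorem wellTuned_of_constant_rate {A : MatField d} {ω : Fin d → ℝ}
    (hA : ∀ θ φ, (A θ φ)ᵀ = -A θ φ) {U : (Fin d → ℝ) → ℝ → M3} {ν : ℝ}
    (h : ∀ φ₀, IsProperUPF A ω φ₀ (U φ₀) ν) : WellTuned A ω :=
  ⟨fun φ₀ => ⟨U φ₀, ν, h φ₀⟩, fun φ₁ φ₂ _ _ _ _ h₁ h₂ =>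
    (h₁.tuneEquiv hA (h φ₁)).trans ((h φ₂).tuneEquiv hA h₂)⟩

/-! ### The straightened frame field off orbital resonance -/

/-- Off orbital resonance the mean of `c_𝒱` does not depend on the orbit. -/
theorem cBar_eq_of_offOrbitalResonance {A V : MatField d} {ω : Fin d → ℝ} (hA : IsSpinSystem A)
    (hV : IsIFF A ω V) (hω : OffOrbitalResonance ω)
    (hmean : ∀ φ₀, HasMean (cV A ω V φ₀) (cBar A ω V φ₀)) (φ₁ φ₂ : Fin d → ℝ) :
    cBar A ω V φ₁ = cBar A ω V φ₂ := by
  have hp := periodicVec_joint (periodicTheta_CC ω hA.periodicTheta hV.2)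
    (periodicPhi_CC ω hA.periodicPhi hV.1.2.2.1)
  have hc := continuous_joint
    (isCr_CC (n := 0) ω (fun i j => (hA.smooth i j).of_le zero_le_one) hV.1.2.1)
  have hm : ∀ φ₀, HasComplexMean (fun θ => (Complex.ofReal ∘ joint (CC A ω V))
      (Fin.cons 0 φ₀ + θ • tuneVec ω)) (cBar A ω V φ₀) := by
    intro φ₀
    have := (hmean φ₀).ofReal
    simp only [Function.comp_apply, joint_orbit]
    exact this
  exact_mod_cast (hm φ₁).eq_of_nonresonant (Complex.continuous_ofReal.comp hc)
    (fun z i => congrArg Complex.ofReal (hp z i)) hω (hm φ₂)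

/-- Off orbital resonance the straightened frame field is smooth and rotates at the constant
rate `ν_𝒱`. -/
theorem isIFF_UU {A V : MatField d} {ω : Fin d → ℝ} {α : ℝ → (Fin d → ℝ) → ℝ}
    (hA : IsSpinSystem A) (hV : IsIFF A ω V) (h : SolvesCohomological A ω V α)
    (hconst : ∀ φ₁ φ₂, cBar A ω V φ₁ = cBar A ω V φ₂) :
    IsIFF A ω (UU A ω V α) ∧ ∀ θ φ φ₀, CC A ω (UU A ω V α) θ φ = nuV A ω V φ₀ := by
  have hk : ∀ φ, kV A ω V φ = kV A ω V 0 := fun φ => by rw [kV, kV, hconst φ 0]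
  have hU : UU A ω V α = fun θ φ => V θ φ * expJ (α θ φ + (kV A ω V 0 : ℝ) * θ) := by
    funext θ φ
    rw [UU, hk]
  have hSO : ∀ θ φ, IsSO3 (UU A ω V α θ φ) := fun θ φ => (hV.1.1 θ φ).mul (isSO3_expJ _)
  have hcol : ∀ θ φ i, UU A ω V α θ φ i 2 = V θ φ i 2 := by
    intro θ φ i
    simp [UU, expJ_eq, Matrix.mul_apply, Fin.sum_univ_three]
  have hC : (UU A ω V α).IsCr 1 := by
    intro i j
    have h2 : ∀ i j, ContDiff ℝ 1 fun p : ℝ × (Fin d → ℝ) =>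
        expJ (α p.1 p.2 + (kV A ω V 0 : ℝ) * p.1) i j := fun i j =>
      (contDiff_expJ_apply i j).comp (ContDiff.add h.1 (contDiff_const.mul contDiff_fst))
    rw [hU]
    simp only [IsCr, Matrix.mul_apply]
    exact ContDiff.sum fun l _ => ContDiff.mul (hV.1.2.1 i l) (h2 l j)
  have hθ : PeriodicTheta (UU A ω V α) := by
    intro t x
    simp only [hU, hV.2 _ _, h.2.1 _ _, mul_add, ← add_assoc, expJ_add_int]
  have hφ : PeriodicPhi (UU A ω V α) := by
    intro t x l
    simp only [hU, hV.1.2.2.1 _ _ _, h.2.2.1 _ _ _]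
  refine ⟨⟨⟨hSO, hC, hφ, ?_⟩, hθ⟩, fun θ φ φ₀ => ?_⟩
  · simp only [hcol]
    exact hV.1.2.2.2
  · refine CC_eq_of_DDMat (hSO θ φ) ?_
    ext i j
    have e : θ • ω + (φ - θ • ω) = φ := by abel
    have h1 := hasDerivAt_orbit_matrix hC ω (φ - θ • ω) θ i j
    have h2 := hasDerivAt_rotated_frame hA.skew hV.1 (h.hasDerivAt_angle (φ - θ • ω) θ) i j
    have h3 : (fun t => UU A ω V α t (t • ω + (φ - θ • ω)) i j) = fun t =>
        (V t (t • ω + (φ - θ • ω)) * expJ (α t (t • ω + (φ - θ • ω)) +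
          (kV A ω V (φ - θ • ω) : ℝ) * t)) i j := by
      funext t
      exact congrFun (congrFun (UFrame_eq A ω V α (φ - θ • ω) t) i) j
    rw [h3] at h1
    have h4 := h1.unique h2
    rw [e] at h4
    rw [h4, nuV, nuV, hconst (φ - θ • ω) φ₀, UU]

/-- Off orbital resonance, a solution of the cohomological equation straightens an invariant
frame field into a uniform one, and the torus is well-tuned. -/
theorem straightened_frame {A V : MatField d} {ω : Fin d → ℝ} {α : ℝ → (Fin d → ℝ) → ℝ}
    (hA : IsSpinSystem A) (hV : IsIFF A ω V) (h : SolvesCohomological A ω V α)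
    (hω : OffOrbitalResonance ω) :
    IsUniformIFF A ω (UU A ω V α) ∧
      (∀ θ φ φ₀, CC A ω (UU A ω V α) θ φ = nuV A ω V φ₀) ∧ WellTuned A ω := by
  have hmean := fun φ₀ => hasMean_cV hA hV.1 h.1 h.2.1 h.2.2.1 (h.DD_orbit φ₀)
  have hconst := cBar_eq_of_offOrbitalResonance hA hV hω hmean
  obtain ⟨hI, hCC⟩ := isIFF_UU hA hV h hconst
  refine ⟨⟨hI, nuV A ω V 0, ⟨Int.fract_nonneg _, Int.fract_lt_one _⟩, fun θ φ => hCC θ φ 0⟩,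
    hCC, wellTuned_of_constant_rate hA.skew (U := UFrame A ω V α) (ν := nuV A ω V 0) fun φ₀ => ?_⟩
  have hν : nuV A ω V 0 = nuV A ω V φ₀ := by rw [nuV, nuV, hconst 0 φ₀]
  rw [hν]
  exact isProperUPF_UFrame hA hV h φ₀

/-! ### Decay of the Fourier coefficients of smooth periodic functions -/

theorem summable_norm_rpow_int (k : ℕ) {s : ℝ} (hs : s < -k) :
    Summable fun m : Fin k → ℤ => ‖m‖ ^ s := by
  let L := Submodule.span ℤ (Set.range (Pi.basisFun ℝ (Fin k)))
  have hL : Module.finrank ℤ L = k := by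
    rw [ZLattice.rank ℝ L, Module.finrank_fin_fun]
  have h := ZLattice.summable_norm_rpow L s (by rwa [hL])
  let e : (Fin k → ℤ) → L := fun m => ⟨fun i => (m i : ℝ), by
    rw [show (fun i => (m i : ℝ)) = ∑ i, m i • Pi.basisFun ℝ (Fin k) i by
      ext j
      simp [Finset.sum_apply, Pi.single_apply]]
    exact Submodule.sum_mem _ fun i _ =>
      Submodule.smul_mem _ _ (Submodule.subset_span (Set.mem_range_self i))⟩
  have he : Function.Injective e := by
    intro m n hmn
    ext i
    have : (m i : ℝ) = n i := congrFun (congrArg Subtype.val hmn) i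
    exact_mod_cast this
  refine (h.comp_injective he).congr fun m => ?_
  have : ‖e m‖ = ‖m‖ := by
    change ‖fun i => (m i : ℝ)‖ = ‖m‖
    refine le_antisymm ?_ ?_
    · refine (pi_norm_le_iff_of_nonneg (norm_nonneg _)).2 fun i => ?_
      rw [Int.norm_cast_real]
      exact norm_le_pi_norm m i
    · refine (pi_norm_le_iff_of_nonneg (norm_nonneg _)).2 fun i => ?_
      rw [← Int.norm_cast_real]
      exact norm_le_pi_norm (fun i => (m i : ℝ)) i
  rw [Function.comp_apply, this]

/-- The normalized Haar measure of the circle, with respect to which `mFourierCoeff` is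
defined. -/
noncomputable local instance : MeasureSpace UnitAddCircle := ⟨AddCircle.haarAddCircle⟩

local instance : Measure.IsAddHaarMeasure (volume : Measure UnitAddCircle) :=
  inferInstanceAs (Measure.IsAddHaarMeasure AddCircle.haarAddCircle)

local instance : IsProbabilityMeasure (volume : Measure UnitAddCircle) :=
  inferInstanceAs (IsProbabilityMeasure AddCircle.haarAddCircle)

open UnitAddTorus

theorem toTorus_add {k : ℕ} (z w : Fin k → ℝ) : toTorus (z + w) = toTorus z + toTorus w := by
  ext i
  simp [toTorus, add_div]

theorem toTorus_surjective (k : ℕ) :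
    Function.Surjective (toTorus : (Fin k → ℝ) → UnitAddTorus (Fin k)) :=
  (isOpenQuotientMap_toTorus k).surjective

/-- Translating a function multiplies its Fourier coefficients by a character. -/
theorem integral_mFourier_translate {k : ℕ} (g : C(UnitAddTorus (Fin k), ℂ)) (m : Fin k → ℤ)
    (w : Fin k → ℝ) :
    ∫ x, mFourier (-m) x * g (x + toTorus w) = character m w * mFourierCoeff g m := by
  have h : ∀ x, mFourier (-m) x * g (x + toTorus w) =
      character m w * (mFourier (-m) (x + toTorus w) * g (x + toTorus w)) := by
    intro x
    obtain ⟨z, rfl⟩ := toTorus_surjective k x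
    have h1 : character m w * character (-m) w = 1 := by
      rw [character, character, intDot_neg_left, ← Complex.exp_add]
      simp
    rw [← toTorus_add, mFourier_toTorus, mFourier_toTorus, character_add, ← mul_assoc,
      mul_left_comm (character m w), h1, mul_one]
  simp_rw [h]
  rw [integral_const_mul, integral_add_right_eq_self (fun x => mFourier (-m) x * g x)]
  rfl

/-- The Fourier coefficients of a partial derivative, obtained by differentiating
`integral_mFourier_translate` in the translation. -/
theorem mFourierCoeff_partial {k : ℕ} {F : (Fin k → ℝ) → ℂ} (hF : ContDiff ℝ 1 F) (i : Fin k)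
    {g g' : C(UnitAddTorus (Fin k), ℂ)} (hg : ∀ z, g (toTorus z) = F z)
    (hg' : ∀ z, g' (toTorus z) = fderiv ℝ F z (Pi.single i 1)) (m : Fin k → ℤ) :
    mFourierCoeff g' m = (m i * Complex.I) * mFourierCoeff g m := by
  have hsingle : ∀ t : ℝ, (Pi.single i t : Fin k → ℝ) = t • Pi.single i 1 := by
    intro t
    rw [← Pi.single_smul, smul_eq_mul, mul_one]
  have hder : ∀ (x : UnitAddTorus (Fin k)) (t : ℝ),
      HasDerivAt (fun t : ℝ => mFourier (-m) x * g (x + toTorus (Pi.single i t)))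
        (mFourier (-m) x * g' (x + toTorus (Pi.single i t))) t := by
    intro x t
    obtain ⟨z, rfl⟩ := toTorus_surjective k x
    simp only [← toTorus_add, hg, hg']
    refine HasDerivAt.const_mul _ ?_
    have hl : HasDerivAt (fun t : ℝ => z + Pi.single i t) (Pi.single i 1) t := by
      rw [show (fun t : ℝ => z + Pi.single i t) = fun t => z + t • Pi.single i (1 : ℝ) from
        funext fun t => by rw [hsingle t]]
      simpa using ((hasDerivAt_id t).smul_const (Pi.single i (1 : ℝ) : Fin k → ℝ)).const_add z
    exact ((hF.differentiable (by norm_num)).differentiableAt.hasFDerivAt.comp_hasDerivAt t hl)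
  have hcont : ∀ (h : C(UnitAddTorus (Fin k), ℂ)) (t : ℝ),
      Continuous fun x => mFourier (-m) x * h (x + toTorus (Pi.single i t)) := by
    intro h t
    fun_prop
  have h1 := (hasDerivAt_integral_of_dominated_loc_of_deriv_le (μ := volume) (x₀ := (0 : ℝ))
    (F := fun t x => mFourier (-m) x * g (x + toTorus (Pi.single i t)))
    (F' := fun t x => mFourier (-m) x * g' (x + toTorus (Pi.single i t)))
    (s := Set.univ) (bound := fun _ => ‖g'‖) univ_mem
    (Eventually.of_forall fun t => (hcont g t).aestronglyMeasurable)
    ((hcont g 0).integrable_of_hasCompactSupport (HasCompactSupport.of_compactSpace _))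
    (hcont g' 0).aestronglyMeasurable
    (Eventually.of_forall fun x t _ => by
      rw [norm_mul]
      have := (mFourier (-m)).norm_coe_le_norm x
      rw [mFourier_norm] at this
      simpa using mul_le_mul this (g'.norm_coe_le_norm _) (norm_nonneg _) zero_le_one)
    (integrable_const _) (Eventually.of_forall fun x t _ => hder x t)).2
  have h2 : HasDerivAt (fun t : ℝ => character m (Pi.single i t) * mFourierCoeff g m)
      ((m i * Complex.I) * mFourierCoeff g m) 0 := by
    refine HasDerivAt.mul_const ?_ _
    have h3 : HasDerivAt (fun t : ℝ => ((m i * t : ℝ) : ℂ) * Complex.I) (m i * Complex.I) 0 := by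
      refine HasDerivAt.mul_const ?_ _
      have := ((hasDerivAt_id (0 : ℝ)).const_mul (m i : ℝ)).ofReal_comp
      simpa using this
    simpa [character, intDot_single] using h3.cexp
  simp only [integral_mFourier_translate] at h1
  have h4 := h1.unique h2
  simpa [character, intDot] using h4

theorem norm_mFourierCoeff_le {k : ℕ} (g : C(UnitAddTorus (Fin k), ℂ)) (m : Fin k → ℤ) :
    ‖mFourierCoeff g m‖ ≤ ‖g‖ := by
  refine (norm_integral_le_of_norm_le_const (C := ‖g‖) (Eventually.of_forall fun x => ?_)).trans
    (by simp)
  rw [norm_smul]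
  have := (mFourier (-m)).norm_coe_le_norm x
  rw [mFourier_norm] at this
  simpa using mul_le_mul this (g.norm_coe_le_norm _) (norm_nonneg _) zero_le_one

theorem PeriodicVec.fderiv_apply {k : ℕ} {F : (Fin k → ℝ) → ℂ} (hF : PeriodicVec F)
    (v : Fin k → ℝ) : PeriodicVec fun z => fderiv ℝ F z v := by
  intro z i
  have h := fderiv_comp_add_right (𝕜 := ℝ) (f := F) (x := z)
    (Pi.single i (2 * Real.pi) : Fin k → ℝ)
  simp only [hF _ i] at h
  simp only [h]

/-- Each derivative in the `i`-th variable multiplies the Fourier coefficients by `i mᵢ`. -/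
theorem exists_bound_mFourierCoeff_mul_pow {k : ℕ} (i : Fin k) (n : ℕ) :
    ∀ {F : (Fin k → ℝ) → ℂ}, ContDiff ℝ n F → PeriodicVec F →
      ∀ {g : C(UnitAddTorus (Fin k), ℂ)}, (∀ z, g (toTorus z) = F z) →
        ∃ C, ∀ m : Fin k → ℤ, ‖mFourierCoeff g m‖ * ‖m i‖ ^ n ≤ C := by
  induction n with
  | zero =>
    intro F _ _ g _
    exact ⟨‖g‖, fun m => by simpa using norm_mFourierCoeff_le g m⟩
  | succ n ih =>
    intro F hF hp g hg
    have hF' : ContDiff ℝ n fun z => fderiv ℝ F z (Pi.single i 1) :=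
      (hF.fderiv_right (by push_cast; exact le_rfl)).clm_apply contDiff_const
    obtain ⟨g', hg'⟩ := exists_torus_lift hF'.continuous (hp.fderiv_apply (Pi.single i 1))
    obtain ⟨C, hC⟩ := ih hF' (hp.fderiv_apply _) hg'
    refine ⟨C, fun m => ?_⟩
    have h := hC m
    rw [mFourierCoeff_partial (hF.of_le (by push_cast; simp)) i hg hg', norm_mul, norm_mul,
      Complex.norm_I, mul_one, Complex.norm_intCast] at h
    rw [pow_succ, Int.norm_eq_abs]
    rw [Int.norm_eq_abs] at h
    linarith

/-- The Fourier coefficients of a periodic `C^n` function decay like `‖m‖⁻ⁿ`. -/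
theorem exists_bound_mFourierCoeff {k n : ℕ} {F : (Fin k → ℝ) → ℂ} (hF : ContDiff ℝ n F)
    (hp : PeriodicVec F) {g : C(UnitAddTorus (Fin k), ℂ)} (hg : ∀ z, g (toTorus z) = F z) :
    ∃ C, 0 ≤ C ∧ ∀ m : Fin k → ℤ, m ≠ 0 → ‖mFourierCoeff g m‖ ≤ C * ‖m‖ ^ (-(n : ℝ)) := by
  choose C hC using fun i => exists_bound_mFourierCoeff_mul_pow i n hF hp hg
  refine ⟨∑ i, |C i|, Finset.sum_nonneg fun _ _ => abs_nonneg _, fun m hm => ?_⟩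
  obtain ⟨j, -⟩ := Function.ne_iff.1 hm
  have : Nonempty (Fin k) := ⟨j⟩
  -- Use the decay in the direction of the largest entry of `m`.
  obtain ⟨i, -, hmax⟩ := Finset.exists_max_image Finset.univ (fun i => ‖m i‖)
    Finset.univ_nonempty
  have hi : ‖m i‖ = ‖m‖ := le_antisymm (norm_le_pi_norm m i)
    ((pi_norm_le_iff_of_nonneg (norm_nonneg _)).2 fun l => hmax l (Finset.mem_univ l))
  have hpos : 0 < ‖m‖ := norm_pos_iff.2 hm
  rw [Real.rpow_neg hpos.le, Real.rpow_natCast, ← div_eq_mul_inv, le_div_iff₀ (by positivity),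
    ← hi]
  exact (hC i m).trans ((le_abs_self _).trans
    (Finset.single_le_sum (f := fun i => |C i|) (fun _ _ => abs_nonneg _) (Finset.mem_univ i)))

/-! ### Almost every tune is Diophantine -/

theorem one_le_norm_of_ne_zero {k : ℕ} {m : Fin k → ℤ} (hm : m ≠ 0) : 1 ≤ ‖m‖ := by
  obtain ⟨i, hi⟩ := Function.ne_iff.1 hm
  refine le_trans ?_ (norm_le_pi_norm m i)
  rw [Int.norm_eq_abs]
  exact_mod_cast Int.one_le_abs hi

/-- The part of a bounded region on which a nonconstant integral affine form is smaller than `δ`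
has measure `O(δ)`, uniformly in the form. -/
theorem exists_volume_slab_le (d : ℕ) (N : ℝ) :
    ∃ C : ENNReal, C ≠ ⊤ ∧ ∀ m : Fin (d + 1) → ℤ, Fin.tail m ≠ 0 → ∀ δ : ℝ,
      volume {ω : Fin d → ℝ | ‖ω‖ ≤ N ∧ |intDot m (tuneVec ω)| < δ} ≤ ENNReal.ofReal δ * C := by
  cases d with
  | zero =>
    exact ⟨0, ENNReal.zero_ne_top, fun m hm => absurd (Subsingleton.elim _ _) hm⟩
  | succ n =>
    refine ⟨2 * volume (Metric.closedBall (0 : Fin n → ℝ) N),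
      ENNReal.mul_ne_top (by simp) measure_closedBall_lt_top.ne, fun m hm δ => ?_⟩
    obtain ⟨i, hi⟩ := Function.ne_iff.1 hm
    have ha : (1 : ℝ) ≤ |(Fin.tail m i : ℝ)| := by exact_mod_cast Int.one_le_abs hi
    have ha0 : (Fin.tail m i : ℝ) ≠ 0 := fun h => by simp [h] at ha; linarith
    let c : (Fin n → ℝ) → ℝ := fun y =>
      m 0 + ∑ j, (Fin.tail m (i.succAbove j) : ℝ) * y j
    let T : Set (ℝ × (Fin n → ℝ)) :=
      {p | p.2 ∈ Metric.closedBall (0 : Fin n → ℝ) N ∧ |c p.2 + Fin.tail m i * p.1| < δ}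
    have hT : MeasurableSet T := by
      have hc : Continuous c := by fun_prop
      refine MeasurableSet.inter ?_ ?_
      · exact measurable_snd Metric.isClosed_closedBall.measurableSet
      · exact (isOpen_lt (by fun_prop : Continuous fun p : ℝ × (Fin n → ℝ) =>
          |c p.2 + (Fin.tail m i : ℝ) * p.1|) continuous_const).measurableSet
    have hmp := volume_preserving_piFinSuccAbove (fun _ : Fin (n + 1) => ℝ) i
    have hsub : {ω : Fin (n + 1) → ℝ | ‖ω‖ ≤ N ∧ |intDot m (tuneVec ω)| < δ} ⊆
        MeasurableEquiv.piFinSuccAbove (fun _ : Fin (n + 1) => ℝ) i ⁻¹' T := by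
      rintro ω ⟨hN, hδ⟩
      refine ⟨?_, ?_⟩
      · rw [mem_closedBall_zero_iff]
        refine (pi_norm_le_iff_of_nonneg ((norm_nonneg _).trans hN)).2 fun j => ?_
        exact (norm_le_pi_norm ω (i.succAbove j)).trans hN
      · rw [intDot_tuneVec, intDot, Fin.sum_univ_succAbove _ i] at hδ
        convert hδ using 2
        simp only [c, MeasurableEquiv.piFinSuccAbove_apply, Fin.insertNthEquiv_symm_apply,
          Fin.removeNth_apply]
        ring
    have hslice : ∀ y, volume ((fun x => (x, y)) ⁻¹' T) ≤
        (Metric.closedBall (0 : Fin n → ℝ) N).indicator (fun _ => ENNReal.ofReal (2 * δ)) y := by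
      intro y
      by_cases hy : y ∈ Metric.closedBall (0 : Fin n → ℝ) N
      · rw [Set.indicator_of_mem hy, ← Real.volume_ball (-(c y / Fin.tail m i))]
        refine measure_mono fun x hx => ?_
        have hx2 : |c y + Fin.tail m i * x| < δ := hx.2
        rw [Metric.mem_ball, Real.dist_eq, sub_neg_eq_add]
        have : c y + Fin.tail m i * x = Fin.tail m i * (x + c y / Fin.tail m i) := by
          field_simp
          ring
        rw [this, abs_mul] at hx2
        exact (le_mul_of_one_le_left (abs_nonneg _) ha).trans_lt hx2
      · have : (fun x : ℝ => (x, y)) ⁻¹' T = ∅ := by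
          ext x
          simp only [Set.mem_preimage, Set.mem_empty_iff_false, iff_false]
          exact fun h => hy h.1
        rw [this, measure_empty]
        exact zero_le
    calc _ ≤ volume (MeasurableEquiv.piFinSuccAbove (fun _ : Fin (n + 1) => ℝ) i ⁻¹' T) :=
          measure_mono hsub
      _ = volume T := hmp.measure_preimage_equiv T
      _ = ∫⁻ y, volume ((fun x => (x, y)) ⁻¹' T) := Measure.prod_apply_symm hT
      _ ≤ ∫⁻ y, (Metric.closedBall (0 : Fin n → ℝ) N).indicator
            (fun _ => ENNReal.ofReal (2 * δ)) y := lintegral_mono hslice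
      _ = ENNReal.ofReal (2 * δ) * volume (Metric.closedBall (0 : Fin n → ℝ) N) := by
          rw [lintegral_indicator Metric.isClosed_closedBall.measurableSet, setLIntegral_const]
      _ = _ := by
          rw [ENNReal.ofReal_mul (by norm_num), ENNReal.ofReal_ofNat]
          ring

theorem exists_pos_lower_bound {ι : Type*} {s : Set ι} (hs : s.Finite) {f : ι → ℝ}
    (hf : ∀ i ∈ s, 0 < f i) : ∃ γ : ℝ, 0 < γ ∧ γ ≤ 1 ∧ ∀ i ∈ s, γ ≤ f i := by
  induction s, hs using Set.Finite.induction_on with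
  | empty => exact ⟨1, one_pos, le_rfl, by simp⟩
  | @insert a s _ _ ih =>
    obtain ⟨γ, h0, h1, h⟩ := ih fun i hi => hf i (Set.mem_insert_of_mem _ hi)
    refine ⟨min γ (f a), lt_min h0 (hf a (Set.mem_insert _ _)), (min_le_left _ _).trans h1, ?_⟩
    rintro i (rfl | hi)
    · exact min_le_right _ _
    · exact (min_le_left _ _).trans (h i hi)

/-- A tune violating the Diophantine inequality with constant `1` only finitely often, and never
exactly resonant, is Diophantine. -/
theorem mem_diophantineSet_of_finite {τ : ℝ} {ω : Fin d → ℝ}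
    (hres : ∀ m : Fin (d + 1) → ℤ, m ≠ 0 → intDot m (tuneVec ω) ≠ 0)
    (hfin : {m : Fin (d + 1) → ℤ | m ≠ 0 ∧ |intDot m (tuneVec ω)| < ‖m‖ ^ (-τ)}.Finite) :
    ω ∈ DiophantineSet d τ := by
  obtain ⟨γ, h0, h1, h⟩ := exists_pos_lower_bound hfin
    (f := fun m => |intDot m (tuneVec ω)| / ‖m‖ ^ (-τ)) fun m hm =>
      div_pos (abs_pos.2 (hres m hm.1)) (Real.rpow_pos_of_pos (norm_pos_iff.2 hm.1) _)
  refine ⟨γ, h0, h1, fun m hm => ?_⟩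
  have hpos : 0 < ‖m‖ ^ (-τ) := Real.rpow_pos_of_pos (norm_pos_iff.2 hm) _
  by_cases hlt : |intDot m (tuneVec ω)| < ‖m‖ ^ (-τ)
  · exact (le_div_iff₀ hpos).1 (h m ⟨hm, hlt⟩)
  · exact (mul_le_of_le_one_left hpos.le h1).trans (not_lt.1 hlt)

theorem one_le_abs_intDot_of_tail_eq_zero {m : Fin (d + 1) → ℤ} (hm : m ≠ 0)
    (ht : Fin.tail m = 0) (ω : Fin d → ℝ) : 1 ≤ |intDot m (tuneVec ω)| := by
  have h0 : m 0 ≠ 0 := fun h => hm (by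
    funext i
    exact Fin.cases h (fun j => congrFun ht j) i)
  rw [intDot_tuneVec, ht]
  simp only [intDot, Pi.zero_apply, Int.cast_zero, zero_mul, Finset.sum_const_zero, add_zero]
  exact_mod_cast Int.one_le_abs h0

/-- For `τ > d + 1`, almost every tune is in `Ω(τ)`: a Borel–Cantelli argument over the slabs
around the resonances, whose measures `O(‖m‖^{-τ})` are summable over `ℤ^{d+1}`. -/
theorem ae_mem_diophantineSet {τ : ℝ} (hτd : d + 1 < τ) :
    ∀ᵐ ω ∂(volume : Measure (Fin d → ℝ)), ω ∈ DiophantineSet d τ := by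
  have hτ : 0 < τ := lt_of_le_of_lt (by positivity) hτd
  have hsum : Summable fun m : Fin (d + 1) → ℤ => ‖m‖ ^ (-τ) :=
    summable_norm_rpow_int (d + 1) (by push_cast; linarith)
  have key : ∀ N : ℕ, ∀ᵐ ω ∂(volume : Measure (Fin d → ℝ)), ‖ω‖ ≤ N →
      ω ∈ DiophantineSet d τ := by
    intro N
    obtain ⟨C, hC, hvol⟩ := exists_volume_slab_le d N
    have hfin : ∀ᵐ ω ∂(volume : Measure (Fin d → ℝ)),
        {m : Fin (d + 1) → ℤ | ω ∈ {ω : Fin d → ℝ | m ≠ 0 ∧ ‖ω‖ ≤ N ∧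
          |intDot m (tuneVec ω)| < ‖m‖ ^ (-τ)}}.Finite := by
      refine ae_finite_setOfPred_mem (ne_top_of_le_ne_top (b := ∑' m : Fin (d + 1) → ℤ,
        ENNReal.ofReal (‖m‖ ^ (-τ)) * C) ?_ (ENNReal.tsum_le_tsum fun m => ?_))
      · rw [ENNReal.tsum_mul_right]
        exact ENNReal.mul_ne_top hsum.tsum_ofReal_ne_top hC
      · by_cases ht : Fin.tail m = 0
        · have : {ω : Fin d → ℝ | m ≠ 0 ∧ ‖ω‖ ≤ N ∧ |intDot m (tuneVec ω)| < ‖m‖ ^ (-τ)} = ∅ := by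
            ext ω
            simp only [Set.mem_ofPred_eq, Set.mem_empty_iff_false, iff_false]
            rintro ⟨hm, -, hlt⟩
            have h1 := one_le_abs_intDot_of_tail_eq_zero hm ht ω
            have h2 := Real.rpow_le_one_of_one_le_of_nonpos (one_le_norm_of_ne_zero hm)
              (neg_nonpos.2 hτ.le)
            linarith
          rw [this, measure_empty]
          exact zero_le
        · exact (measure_mono fun ω h => h.2).trans (hvol m ht _)
    have hres : ∀ᵐ ω ∂(volume : Measure (Fin d → ℝ)), ∀ m : Fin (d + 1) → ℤ, m ≠ 0 →
        ‖ω‖ ≤ N → intDot m (tuneVec ω) ≠ 0 := by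
      refine ae_all_iff.2 fun m => ?_
      by_cases ht : Fin.tail m = 0
      · refine Eventually.of_forall fun ω hm _ h0 => ?_
        have := one_le_abs_intDot_of_tail_eq_zero hm ht ω
        rw [h0] at this
        norm_num at this
      · have hz : volume {ω : Fin d → ℝ | ‖ω‖ ≤ N ∧ intDot m (tuneVec ω) = 0} = 0 := by
          have hle : ∀ᶠ δ : ℝ in 𝓝[>] 0,
              volume {ω : Fin d → ℝ | ‖ω‖ ≤ N ∧ intDot m (tuneVec ω) = 0} ≤
                ENNReal.ofReal δ * C := by
            filter_upwards [self_mem_nhdsWithin] with δ hδ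
            refine (measure_mono (t := {ω : Fin d → ℝ | ‖ω‖ ≤ N ∧ |intDot m (tuneVec ω)| < δ})
              fun ω h => ⟨h.1, ?_⟩).trans (hvol m ht δ)
            rw [h.2, abs_zero]
            exact hδ
          have hlim : Tendsto (fun δ : ℝ => ENNReal.ofReal δ * C) (𝓝[>] 0) (𝓝 0) := by
            have h1 : Tendsto (fun δ : ℝ => ENNReal.ofReal δ) (𝓝[>] 0) (𝓝 0) := by
              have := (ENNReal.continuous_ofReal.tendsto 0).mono_left
                (nhdsWithin_le_nhds (s := Set.Ioi 0))
              rwa [ENNReal.ofReal_zero] at this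
            simpa using ENNReal.Tendsto.mul_const h1 (Or.inr hC)
          exact le_antisymm (ge_of_tendsto hlim hle) zero_le
        have := measure_eq_zero_iff_ae_notMem.1 hz
        filter_upwards [this] with ω h _ hN h0
        exact h ⟨hN, h0⟩
    filter_upwards [hfin, hres] with ω h1 h2 hN
    refine mem_diophantineSet_of_finite (fun m hm => h2 m hm hN) (h1.subset fun m hm => ?_)
    exact ⟨hm.1, hN, hm.2⟩
  filter_upwards [ae_all_iff.2 key] with ω h
  obtain ⟨N, hN⟩ := exists_nat_ge ‖ω‖
  exact h N hN

/-! ### The cohomological equation for Diophantine tunes -/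

/-- The linear form `z ↦ i m·z`. -/
noncomputable def phaseForm {k : ℕ} (m : Fin k → ℤ) : (Fin k → ℝ) →L[ℝ] ℂ :=
  ∑ i, (ContinuousLinearMap.proj (R := ℝ) (φ := fun _ : Fin k => ℝ) i).smulRight
    ((m i : ℂ) * Complex.I)

theorem phaseForm_apply {k : ℕ} (m : Fin k → ℤ) (z : Fin k → ℝ) :
    phaseForm m z = intDot m z * Complex.I := by
  simp [phaseForm, intDot, Finset.sum_mul, mul_left_comm, mul_assoc]

theorem norm_phaseForm_le {k : ℕ} (m : Fin k → ℤ) : ‖phaseForm m‖ ≤ k * ‖m‖ := by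
  refine ContinuousLinearMap.opNorm_le_bound _ (by positivity) fun z => ?_
  rw [phaseForm_apply, norm_mul, Complex.norm_I, mul_one, Complex.norm_real, intDot]
  refine (norm_sum_le _ _).trans ?_
  calc ∑ i, ‖(m i : ℝ) * z i‖ ≤ ∑ _i : Fin k, ‖m‖ * ‖z‖ := by
        refine Finset.sum_le_sum fun i _ => ?_
        rw [norm_mul, Int.norm_cast_real]
        exact mul_le_mul (norm_le_pi_norm m i) (norm_le_pi_norm z i) (norm_nonneg _)
          (norm_nonneg _)
    _ = k * ‖m‖ * ‖z‖ := by simp [mul_assoc]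

theorem character_eq_exp_phaseForm {k : ℕ} (m : Fin k → ℤ) (z : Fin k → ℝ) :
    character m z = Complex.exp (phaseForm m z) := by
  rw [phaseForm_apply, character]

theorem hasFDerivAt_character {k : ℕ} (m : Fin k → ℤ) (z : Fin k → ℝ) :
    HasFDerivAt (character m) (character m z • phaseForm m) z := by
  have h := (phaseForm m).hasFDerivAt (x := z).cexp
  rw [← character_eq_exp_phaseForm] at h
  exact h.congr_of_eventuallyEq
    (Eventually.of_forall fun w => character_eq_exp_phaseForm m w)

theorem contDiff_character {k : ℕ} (m : Fin k → ℤ) {n : WithTop ℕ∞} :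
    ContDiff ℝ n (character m) := by
  rw [show character m = fun z => Complex.exp (phaseForm m z) from
    funext (character_eq_exp_phaseForm m)]
  exact (phaseForm m).contDiff.cexp

/-- A Fourier series whose coefficients are summable against `‖m‖` is `C¹` and can be
differentiated term by term. -/
theorem contDiff_fourierSeries {k : ℕ} {b : (Fin k → ℤ) → ℂ} {v : (Fin k → ℤ) → ℝ}
    (hv : Summable v) (hb0 : ∀ m, ‖b m‖ ≤ v m) (hb1 : ∀ m, ‖b m‖ * ‖phaseForm m‖ ≤ v m) :
    ContDiff ℝ 1 (fun z => ∑' m, b m * character m z) ∧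
      ∀ z w, fderiv ℝ (fun z => ∑' m, b m * character m z) z w =
        ∑' m, b m * (intDot m w * Complex.I) * character m z := by
  have hf : ∀ m z, HasFDerivAt (fun z => b m * character m z)
      (b m • character m z • phaseForm m) z :=
    fun m z => (hasFDerivAt_character m z).const_mul (b m)
  have hf0 : ∀ m z, ‖b m * character m z‖ ≤ v m := by
    intro m z
    rw [norm_mul, norm_character, mul_one]
    exact hb0 m
  have hf1 : ∀ m z, ‖b m • character m z • phaseForm m‖ ≤ v m := by
    intro m z
    rw [norm_smul, norm_smul, norm_character, one_mul]
    exact hb1 m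
  constructor
  · refine contDiff_tsum (N := 1) (v := fun _ => v)
      (fun m => contDiff_const.mul (contDiff_character m)) (fun _ _ => hv) fun l m z hl => ?_
    have hl' : l ≤ 1 := by exact_mod_cast hl
    interval_cases l
    · rw [norm_iteratedFDeriv_zero]
      exact hf0 m z
    · rw [norm_iteratedFDeriv_one, (hf m z).fderiv]
      exact hf1 m z
  · intro z w
    have hs : Summable fun m => b m • character m z • phaseForm m :=
      Summable.of_norm_bounded hv fun m => hf1 m z
    rw [(hasFDerivAt_tsum hv hf hf1 (Summable.of_norm_bounded hv fun m => hf0 m z) z).fderiv]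
    refine ((ContinuousLinearMap.apply ℝ ℂ w).map_tsum hs).trans (tsum_congr fun m => ?_)
    simp [phaseForm_apply]
    ring

theorem mul_rpow_le_of_one_le {x C γ τ : ℝ} {n : ℕ} {a l : ℝ} (hx : 1 ≤ x) (hC : 0 ≤ C)
    (hγ : 0 < γ) (ha : a ≤ C * x ^ (-(n : ℝ))) (hl : γ * x ^ (-τ) ≤ l) :
    a / l ≤ C / γ * x ^ (τ - n) := by
  have hx0 : 0 < x := by linarith
  have hp : 0 < γ * x ^ (-τ) := mul_pos hγ (Real.rpow_pos_of_pos hx0 _)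
  calc a / l ≤ (C * x ^ (-(n : ℝ))) / (γ * x ^ (-τ)) :=
        div_le_div₀ (by positivity) ha hp hl
    _ = C / γ * x ^ (τ - n) := by
        rw [mul_div_mul_comm, ← Real.rpow_sub hx0]
        congr 2
        ring

/-- The cohomological equation on the torus: for a Diophantine direction `ν` of exponent `τ` and
a periodic `f` of class `C^n`, `n > k + 1 + τ`, the equation `ν·∇α = f - c` has a `C¹` periodic
solution for a suitable constant `c`. The Fourier coefficients of `α` are those of `f` divided by
the small denominators `i m·ν`. -/
theorem exists_solution_cohomological {k n : ℕ} {f : (Fin k → ℝ) → ℝ} (hf : ContDiff ℝ n f)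
    (hp : PeriodicVec f) {ν : Fin k → ℝ} {γ τ : ℝ} (hγ : 0 < γ)
    (hν : ∀ m : Fin k → ℤ, m ≠ 0 → γ * ‖m‖ ^ (-τ) ≤ |intDot m ν|) (hτ : 0 < τ)
    (hn : k + 1 + τ < n) :
    ∃ (α : (Fin k → ℝ) → ℝ) (c : ℝ), ContDiff ℝ 1 α ∧ PeriodicVec α ∧
      ∀ z, fderiv ℝ α z ν = f z - c := by
  have hF : ContDiff ℝ n (Complex.ofReal ∘ f) := Complex.ofRealCLM.contDiff.comp hf
  have hFp : PeriodicVec (Complex.ofReal ∘ f) := fun z i => congrArg Complex.ofReal (hp z i)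
  obtain ⟨g, hg⟩ := exists_torus_lift hF.continuous hFp
  obtain ⟨C, hC0, hC⟩ := exists_bound_mFourierCoeff hF hFp hg
  set a : (Fin k → ℤ) → ℂ := UnitAddTorus.mFourierCoeff g with ha
  have hsum : Summable fun m : Fin k → ℤ => ‖m‖ ^ (τ - n + 1) :=
    summable_norm_rpow_int k (by linarith)
  have hsuma : Summable a := by
    refine Summable.of_norm_bounded_eventually (hsum.mul_left C) ?_
    filter_upwards [eventually_cofinite_ne (0 : Fin k → ℤ)] with m hm
    refine (hC m hm).trans (mul_le_mul_of_nonneg_left ?_ hC0)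
    exact Real.rpow_le_rpow_of_exponent_le (one_le_norm_of_ne_zero hm) (by linarith)
  have hdot : ∀ m : Fin k → ℤ, m ≠ 0 → intDot m ν ≠ 0 := by
    intro m hm h0
    have h1 := hν m hm
    rw [h0, abs_zero] at h1
    have : 0 < γ * ‖m‖ ^ (-τ) := mul_pos hγ (Real.rpow_pos_of_pos (norm_pos_iff.2 hm) _)
    linarith
  let b : (Fin k → ℤ) → ℂ := fun m => if m = 0 then 0 else a m / (intDot m ν * Complex.I)
  have hb : ∀ m, m ≠ 0 → ‖b m‖ ≤ C / γ * ‖m‖ ^ (τ - n) := by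
    intro m hm
    simp only [b, if_neg hm]
    rw [norm_div, norm_mul, Complex.norm_I, mul_one, Complex.norm_real, Real.norm_eq_abs]
    exact mul_rpow_le_of_one_le (one_le_norm_of_ne_zero hm) hC0 hγ (hC m hm) (hν m hm)
  have hpow : ∀ m : Fin k → ℤ, m ≠ 0 → ‖m‖ ^ (τ - n) * ‖m‖ = ‖m‖ ^ (τ - n + 1) :=
    fun m hm => (Real.rpow_add_one (norm_pos_iff.2 hm).ne' _).symm
  have hb1 : ∀ m, ‖b m‖ * ‖phaseForm m‖ ≤ C / γ * (k + 1) * ‖m‖ ^ (τ - n + 1) := by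
    intro m
    by_cases hm : m = 0
    · simp only [b, if_pos hm, norm_zero, zero_mul]
      positivity
    · calc ‖b m‖ * ‖phaseForm m‖ ≤ (C / γ * ‖m‖ ^ (τ - n)) * ((k + 1) * ‖m‖) := by
            refine mul_le_mul (hb m hm) ((norm_phaseForm_le m).trans ?_) (norm_nonneg _)
              (by positivity)
            gcongr
            linarith
        _ = _ := by
            rw [← hpow m hm]
            ring
  have hb0 : ∀ m, ‖b m‖ ≤ C / γ * (k + 1) * ‖m‖ ^ (τ - n + 1) := by
    intro m
    by_cases hm : m = 0
    · simp only [b, if_pos hm, norm_zero]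
      positivity
    · calc ‖b m‖ ≤ C / γ * ‖m‖ ^ (τ - n) := hb m hm
        _ ≤ C / γ * ‖m‖ ^ (τ - n) * ((k + 1) * ‖m‖) := by
            refine le_mul_of_one_le_right (by positivity) ?_
            have := one_le_norm_of_ne_zero hm
            have hk : (0 : ℝ) ≤ k := by positivity
            nlinarith
        _ = _ := by
            rw [← hpow m hm]
            ring
  obtain ⟨hcd, hfd⟩ := contDiff_fourierSeries (hsum.mul_left (C / γ * (k + 1))) hb0 hb1
  set h : (Fin k → ℝ) → ℂ := fun z => ∑' m, b m * character m z with hh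
  refine ⟨fun z => (h z).re, (a 0).re, Complex.reCLM.contDiff.comp hcd, fun z i => ?_,
    fun z => ?_⟩
  · simp only [hh, periodicVec_character _ z i]
  · have hd := Complex.reCLM.hasFDerivAt.comp z
      (hcd.differentiable (by norm_num)).differentiableAt.hasFDerivAt
    have hd' : fderiv ℝ (fun z => (h z).re) z ν = (fderiv ℝ h z ν).re := by
      have := hd.fderiv
      exact congrArg (fun L => L ν) this
    have hser := UnitAddTorus.hasSum_mFourier_series_apply_of_summable hsuma (toTorus z)
    simp only [mFourier_toTorus, smul_eq_mul, hg] at hser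
    have hser' := hasSum_ite_sub_hasSum hser 0
    rw [hd', hfd]
    have hterm : ∀ m : Fin k → ℤ, b m * (intDot m ν * Complex.I) * character m z =
        if m = 0 then 0 else a m * character m z := by
      intro m
      by_cases hm : m = 0
      · simp [b, hm]
      · have h1 : (intDot m ν : ℂ) * Complex.I ≠ 0 :=
          mul_ne_zero (by exact_mod_cast hdot m hm) Complex.I_ne_zero
        simp only [b, if_neg hm, div_mul_cancel₀ _ h1]
    rw [tsum_congr hterm, hser'.tsum_eq]
    simp [character, intDot]
    rfl

/-- For a Diophantine tune the cohomological equation of a smooth invariant frame field is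
solvable. -/
theorem exists_solvesCohomological {A V : MatField d} {ω : Fin d → ℝ} {n : ℕ} {τ : ℝ}
    (hτ : 0 < τ) (hn : d + 2 + τ < n) (hA : IsSpinSystem A) (hAn : A.IsCr n)
    (hV : IsIFF A ω V) (hVn : V.IsCr (n + 1)) (hω : ω ∈ DiophantineSet d τ) :
    ∃ α, SolvesCohomological A ω V α := by
  obtain ⟨γ, hγ, -, hdio⟩ := hω
  obtain ⟨β, c, hβ, hβp, hβd⟩ := exists_solution_cohomological
    (contDiff_joint (isCr_CC ω hAn hVn))
    (periodicVec_joint (periodicTheta_CC ω hA.periodicTheta hV.2)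
      (periodicPhi_CC ω hA.periodicPhi hV.1.2.2.1)) hγ hdio hτ (by push_cast; linarith)
  let α : ℝ → (Fin d → ℝ) → ℝ := fun θ φ => β (Fin.cons θ φ)
  have hα : IsCr 1 α := by
    refine ContDiff.comp (f := fun p : ℝ × (Fin d → ℝ) => (Fin.cons p.1 p.2 : Fin (d + 1) → ℝ))
      hβ (contDiff_pi.2 fun i => ?_)
    refine Fin.cases ?_ (fun j => ?_) i
    · exact contDiff_fst
    · exact (contDiff_apply ℝ ℝ j).comp contDiff_snd
  have hθ : PeriodicTheta α := by
    intro t x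
    refine (congrArg β ?_).trans (hβp (Fin.cons t x) 0)
    ext i
    refine Fin.cases ?_ (fun j => ?_) i <;> simp
  have hφ : PeriodicPhi α := by
    intro t x l
    refine (congrArg β ?_).trans (hβp (Fin.cons t x) l.succ)
    ext i
    refine Fin.cases ?_ (fun j => ?_) i <;> simp [Pi.single_apply]
  have hcons : ∀ (φ₀ : Fin d → ℝ) (t : ℝ), (Fin.cons t (t • ω + φ₀) : Fin (d + 1) → ℝ) =
      Fin.cons 0 φ₀ + t • tuneVec ω := by
    intro φ₀ t
    ext i
    refine Fin.cases ?_ (fun j => ?_) i <;> simp [tuneVec, add_comm]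
  have hline : ∀ (φ₀ : Fin d → ℝ) (t : ℝ), DD ω α t (t • ω + φ₀) = cV A ω V φ₀ t - c := by
    intro φ₀ t
    have h1 := hasDerivAt_orbit hα ω φ₀ t
    have hl : HasDerivAt (fun t : ℝ => (Fin.cons 0 φ₀ : Fin (d + 1) → ℝ) + t • tuneVec ω)
        (tuneVec ω) t := by
      simpa using ((hasDerivAt_id t).smul_const (tuneVec ω)).const_add
        (Fin.cons 0 φ₀ : Fin (d + 1) → ℝ)
    have h2 := (hβ.differentiable (by norm_num)).differentiableAt.hasFDerivAt.comp_hasDerivAt t hl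
    rw [hβd, joint_orbit] at h2
    simp only [α, hcons] at h1
    exact h1.unique h2
  -- The constant that makes the equation solvable is the mean along every orbit.
  have hmean : ∀ φ₀, cBar A ω V φ₀ = c := fun φ₀ =>
    (hasMean_cV hA hV.1 hα hθ hφ (hline φ₀)).limUnder_eq
  refine ⟨α, hα, hθ, hφ, fun θ φ => ?_⟩
  have := hline (φ - θ • ω) θ
  rwa [add_sub_cancel, ← hmean (φ - θ • ω)] at this

theorem offOrbitalResonance_of_mem_diophantineSet {ω : Fin d → ℝ} {τ : ℝ}
    (hω : ω ∈ DiophantineSet d τ) : OffOrbitalResonance ω := by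
  obtain ⟨γ, hγ, -, h⟩ := hω
  intro m hm
  by_contra hne
  have h1 := h m hne
  rw [hm, abs_zero] at h1
  have : 0 < γ * ‖m‖ ^ (-τ) := mul_pos hγ (Real.rpow_pos_of_pos (norm_pos_iff.2 hne) _)
  linarith

theorem exists_uniformIFF_of_diophantine {r : ℕ} {τ : ℝ} (hτ : 0 < τ) (hr : τ < (r : ℝ) - d - 3)
    {A V : MatField d} {ω : Fin d → ℝ} (hA : IsSpinSystem A) (hAr : A.IsCr r) (hV : IsIFF A ω V)
    (hVr : V.IsCr r) (hω : ω ∈ DiophantineSet d τ) :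
    (∃ W : MatField d, IsUniformIFF A ω W) ∧ WellTuned A ω := by
  obtain _ | n := r
  · have hd : (0 : ℝ) ≤ d := d.cast_nonneg
    push_cast at hr
    linarith
  · obtain ⟨α, hα⟩ := exists_solvesCohomological (n := n) hτ (by push_cast at hr; linarith) hA
      (fun i j => (hAr i j).of_le n.le_succ) hV hVr hω
    have h := straightened_frame hA hV hα (offOrbitalResonance_of_mem_diophantineSet hω)
    exact ⟨⟨_, h.1⟩, h.2.2⟩

end SpinTorus

theorem theorem6p5 (d : ℕ) :
    -- (a)
    (∀ (A : MatField d) (ω : Fin d → ℝ) (V : MatField d) (α : ℝ → (Fin d → ℝ) → ℝ),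
      IsSpinSystem A → IsIFF A ω V → SolvesCohomological A ω V α →
      ∀ φ₀ : Fin d → ℝ,
        HasMean (cV A ω V φ₀) (cBar A ω V φ₀) ∧
        IsProperUPF A ω φ₀ (UFrame A ω V α φ₀) (nuV A ω V φ₀)) ∧
    -- (b)
    (∀ (A : MatField d) (ω : Fin d → ℝ) (V : MatField d) (α : ℝ → (Fin d → ℝ) → ℝ),
      IsSpinSystem A → IsIFF A ω V → SolvesCohomological A ω V α →
      OffOrbitalResonance ω →
        IsUniformIFF A ω (UU A ω V α) ∧
        (∀ θ φ φ₀, CC A ω (UU A ω V α) θ φ = nuV A ω V φ₀) ∧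
        WellTuned A ω ∧
        ∀ φ₀ : Fin d → ℝ,
          IsProperUPF A ω φ₀ (UFrame A ω V α φ₀) (nuV A ω V φ₀) ∧
          IsSpinTune A ω (nuV A ω V φ₀)) ∧
    -- (c)
    (∀ (r : ℕ) (τ : ℝ), 0 < τ → τ < (r : ℝ) - d - 3 →
      ∀ (A : MatField d) (ω : Fin d → ℝ) (V : MatField d),
        IsSpinSystem A → A.IsCr r → IsIFF A ω V → V.IsCr r → ω ∈ DiophantineSet d τ →
        (∃ W : MatField d, IsUniformIFF A ω W) ∧ WellTuned A ω) ∧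
    -- (d)
    (∀ (r : ℕ), 2 * d + 4 < r →
      ∀ (R : Set (Fin d → ℝ)) (A : (Fin d → ℝ) → MatField d), MeasurableSet R →
        (∀ ω ∈ R, IsSpinSystem (A ω) ∧ (A ω).IsCr r ∧
          ∃ V : MatField d, IsIFF (A ω) ω V ∧ V.IsCr r) →
        ∀ᵐ ω ∂(volume : Measure (Fin d → ℝ)), ω ∈ R →
          (∃ W : MatField d, IsUniformIFF (A ω) ω W) ∧ WellTuned (A ω) ω) := by

  refine ⟨fun A ω V α hA hV hα φ₀ => ⟨?_, isProperUPF_UFrame hA hV hα φ₀⟩, ?_, ?_, ?_⟩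
  · exact hasMean_cV hA hV.1 hα.1 hα.2.1 hα.2.2.1 (hα.DD_orbit φ₀)
  · intro A ω V α hA hV hα hω
    obtain ⟨h1, h2, h3⟩ := straightened_frame hA hV hα hω
    have h4 := isProperUPF_UFrame hA hV hα
    exact ⟨h1, h2, h3, fun φ₀ => ⟨h4 φ₀, h3, φ₀, _, h4 φ₀⟩⟩
  · intro r τ hτ hr A ω V hA hAr hV hVr hω
    exact exists_uniformIFF_of_diophantine hτ hr hA hAr hV hVr hω
  · intro r hr R A _ hR
    have hr' : (2 * d + 5 : ℝ) ≤ r := by exact_mod_cast hr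
    -- The exponent has to exceed `d + 1` for Borel–Cantelli and to stay below `r - d - 3 ≥ d + 2`.
    have hτ : (0 : ℝ) < d + 3 / 2 := by positivity
    filter_upwards [ae_mem_diophantineSet (d := d) (τ := d + 3 / 2) (by linarith)]
      with ω hω hωR
    obtain ⟨hA, hAr, V, hV, hVr⟩ := hR ω hωR
    exact exists_uniformIFF_of_diophantine hτ (by linarith) hA hAr hV hVr hω
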